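/- Let $c>0$ and let $\lambda\in C^2((0,\infty),(0,\infty))$ (integrability of $\lambda$ at $0$ is not required). All motions below start at the origin with a direction chosen uniformly, and their changes of direction are timed by a Poisson process with rate function $\lambda$; the choices of direction are independent of the Poisson process. (If $\lambda$ is not integrable at $0$, so that the events accumulate at $0$, this means: for every $s>0$, given all event times, the direction at time $s$ and the directions taken at the subsequent events form a Markov chain with uniform initial law and with the transition rule of the motion. If $\lambda$ is integrable at $0$, this property is equivalent to the description above.) Let $(X,Y,Z)$ be a motion in $\mathbb R^3$ with speed $c$ and directions $\pm(1,0,0),\pm(0,1,0),\pm(0,0,1)$, which is either an orthogonal standard motion (OSM: at each event the new direction is uniform among the four directions orthogonal to the current one) or an orthogonal uniform motion (OUM: at each event the new direction is uniform among all six directions). Let $T_x(t),T_y(t),T_z(t)$ be the times spent up to time $t$ moving parallel to the $x$-, $y$- and $z$-axis. Consider moreover a planar motion with velocities $$v_0=(c,0),\quad v_1=\Bigl(-\tfrac c2,\tfrac{\sqrt3c}2\Bigr),\quad v_2=\Bigl(-\tfrac c2,-\tfrac{\sqrt3c}2\Bigr)$$ and the same rate function $\lambda$, which is (i) if $(X,Y,Z)$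 is an OSM, symmetrically deviating: at each event the new direction is uniform among the two directions different from the current one; (ii) if $(X,Y,Z)$ is an OUM, uniform: at each event the new direction is uniform among all three directions. Then at every time $t>0$ the position of the planar motion has a density $q(t,\cdot,\cdot)$ with respect to Lebesgue measure in the interior of the triangle with vertices $tv_0,tv_1,tv_2$. Moreover, for every $t>0$, $T_x(t)+T_y(t)+T_z(t)=t$ almost surely, and for every version of $q$ the vector $(T_x(t),T_y(t))$ has in the open simplex $\{(s,r): s>0,\ r>0,\ s+r<t\}$ the density $$p(t,s,r)=\frac{3\sqrt3\,c^2}{2}\,q\Bigl(t,\frac c2(3s-t),\frac{\sqrt3c}{2}(s+2r-t)\Bigr),$$ that is, $P\{(T_x(t),T_y(t))\in B\}=\iint_B p(t,s,r)\,ds\,dr$ for every Borel subset $B$ of the open simplex. -/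

import Mathlib

open Set MeasureTheory ProbabilityTheory
open scoped Classical

/-- The number of events in `(s, t]` of the random set of event times `Γ`. -/
noncomputable def eventCount {Ω : Type*} (Γ : Ω → Set ℝ) (s t : ℝ) (ω : Ω) : ℕ :=
  (Γ ω ∩ Ioc s t).ncard

/-- `Γ` is the set of event times of a Poisson process on `(0, ∞)` with rate function `lam`:
events are locally finite in `(0, ∞)`, the number of events in `(s, t]` is Poisson with mean
`∫ u in s..t, lam u`, and the numbers in disjoint intervals are independent.
The events may accumulate at `0`, which happens exactly when `lam` is not integrable there. -/
structure IsPoissonEvents {Ω : Type*} [MeasurableSpace Ω] (P : Measure Ω) (lam : ℝ → ℝ)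
    (Γ : Ω → Set ℝ) : Prop where
  subset_Ioi : ∀ ω, Γ ω ⊆ Ioi 0
  locallyFinite : ∀ ω s t, 0 < s → (Γ ω ∩ Ioc s t).Finite
  measurable_count : ∀ s t, 0 < s → Measurable (eventCount Γ s t)
  count_law : ∀ s t, 0 < s → s ≤ t →
    P.map (eventCount Γ s t) = poissonMeasure (∫ u in s..t, lam u).toNNReal
  indep_counts : ∀ τ : ℕ → ℝ, 0 < τ 0 → Monotone τ →
    iIndepFun (fun k : ℕ => eventCount Γ (τ k) (τ (k + 1))) P

/-- The σ-algebra generated by the numbers of events in the intervals `(s, t]`, `0 < s`. -/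
def eventSigma {Ω : Type*} (Γ : Ω → Set ℝ) : MeasurableSpace Ω :=
  MeasurableSpace.generateFrom
    {A | ∃ s t : ℝ, ∃ n : ℕ, 0 < s ∧ A = {ω | eventCount Γ s t ω = n}}

/-- The transition matrix of the rule "from the direction `i`, the new direction is chosen
uniformly in `A i`". -/
noncomputable def uniformChoice {ι : Type*} (A : ι → Finset ι) (i j : ι) : ℝ :=
  if j ∈ A i then 1 / ((A i).card : ℝ) else 0

/-- `D t ω` is the current direction at time `t > 0` of a motion that starts with a direction
chosen uniformly in `ι` and whose changes of direction are timed by the Poisson events `Γ` with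
rate function `lam`: at every event the new direction is chosen uniformly in `A i`, where `i` is
the current direction, independently of everything else.

The rule is expressed as follows. For `0 < s < t` and given the whole set of event times, if there
are `n` events in `(s, t]`, then the direction at time `s` followed by the directions taken at
these events form a Markov chain with uniform initial law and transition matrix
`uniformChoice A`. If the events do not accumulate at `0` this is the
same as a uniform choice of the direction at time `0+` followed by independent choices (for the
rules `A` used below the uniform law is invariant), and it also makes sense
if they do accumulate at `0`, in which case there is no first direction. -/
structure IsDirectionOfMotion {Ω ι : Type*} [MeasurableSpace Ω] [Fintype ι] (P : Measure Ω)
    (A : ι → Finset ι) (lam : ℝ → ℝ) (Γ : Ω → Set ℝ) (D : ℝ → Ω → ι) : Prop where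
  poisson : IsPoissonEvents P lam Γ
  measurable_direction : ∀ t, 0 < t → ∀ i, MeasurableSet {ω | D t ω = i}
  /-- the direction changes at the events only -/
  const_between : ∀ ω s t, 0 < s → s ≤ t → Γ ω ∩ Ioc s t = ∅ → D t ω = D s ω
  chain : ∀ s t, 0 < s → s < t → ∀ (n : ℕ) (e : ℕ → ι) (B : Set Ω),
    MeasurableSet[eventSigma Γ] B →
    P.real ({ω | eventCount Γ s t ω = n ∧ ∀ u ∈ Icc s t, D u ω = e (eventCount Γ s u ω)} ∩ B)
      = (1 / (Fintype.card ι : ℝ)) * (∏ k ∈ Finset.range n, uniformChoice A (e k) (e (k + 1)))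
        * P.real ({ω | eventCount Γ s t ω = n} ∩ B)

/-- The six orthogonal directions `d₀ = (1,0,0)`, `d₁ = (0,1,0)`, `d₂ = (0,0,1)`, `d₃ = -d₀`,
`d₄ = -d₁`, `d₅ = -d₂` of `ℝ³`. -/
noncomputable def orthDir : Fin 6 → EuclideanSpace ℝ (Fin 3) :=
  ![!₂[1, 0, 0], !₂[0, 1, 0], !₂[0, 0, 1], !₂[-1, 0, 0], !₂[0, -1, 0], !₂[0, 0, -1]]

/-- Orthogonal standard motion: at every event the new direction is chosen uniformly among the
directions orthogonal to the current one. -/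
def IsOSM {Ω : Type*} [MeasurableSpace Ω] (P : Measure Ω) (lam : ℝ → ℝ) (Γ : Ω → Set ℝ)
    (D : ℝ → Ω → Fin 6) : Prop :=
  IsDirectionOfMotion P (fun i => Finset.univ.filter
    (fun j => inner ℝ (orthDir i) (orthDir j) = 0)) lam Γ D

/-- Orthogonal uniform motion: at every event the new direction is chosen uniformly among all the
six directions. -/
def IsOUM {Ω : Type*} [MeasurableSpace Ω] (P : Measure Ω) (lam : ℝ → ℝ) (Γ : Ω → Set ℝ)
    (D : ℝ → Ω → Fin 6) : Prop :=
  IsDirectionOfMotion P (fun _ => Finset.univ) lam Γ D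

/-- The time spent up to time `t` moving parallel to the `i`-th coordinate axis by the motion in
`ℝ³` with speed `c` and current direction `D`, i.e. with velocity `c • orthDir (D u ω)` at
time `u`. -/
noncomputable def axisTime {Ω : Type*} (c : ℝ) (D : ℝ → Ω → Fin 6) (i : Fin 3) (t : ℝ) (ω : Ω) :
    ℝ :=
  volume.real {u : ℝ | u ∈ Ioc 0 t ∧
    ∃ a : ℝ, c • orthDir (D u ω) = a • EuclideanSpace.single i (1 : ℝ)}

/-- The velocities `v₀ = (c,0)`, `v₁ = (-c/2, √3c/2)`, `v₂ = (-c/2, -√3c/2)` of the planar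
three-direction motion. -/
noncomputable def planarVel (c : ℝ) : Fin 3 → ℝ × ℝ :=
  ![(c, 0), (-c / 2, Real.sqrt 3 * c / 2), (-c / 2, -(Real.sqrt 3 * c / 2))]

/-- Symmetrically deviating planar motion: at every event the new direction is chosen uniformly
among the two directions different from the current one. -/
def IsSymmetricallyDeviatingPlanar {Ω : Type*} [MeasurableSpace Ω] (P : Measure Ω) (lam : ℝ → ℝ)
    (Γ : Ω → Set ℝ) (D : ℝ → Ω → Fin 3) : Prop :=
  IsDirectionOfMotion P (fun i => Finset.univ.erase i) lam Γ D

/-- Uniform planar motion: at every event the new direction is chosen uniformly among all the three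
directions. -/
def IsUniformPlanar {Ω : Type*} [MeasurableSpace Ω] (P : Measure Ω) (lam : ℝ → ℝ)
    (Γ : Ω → Set ℝ) (D : ℝ → Ω → Fin 3) : Prop :=
  IsDirectionOfMotion P (fun _ => Finset.univ) lam Γ D

/-- The position at time `t` of the planar motion, started at the origin. -/
noncomputable def planarPosition {Ω : Type*} (c : ℝ) (D : ℝ → Ω → Fin 3) (t : ℝ) (ω : Ω) :
    ℝ × ℝ :=
  ∫ u in (0 : ℝ)..t, planarVel c (D u ω)

/-- The interior of the triangle with vertices `t • v₀`, `t • v₁`, `t • v₂`. -/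
def openTriangle (c t : ℝ) : Set (ℝ × ℝ) :=
  {z | -(c * t / 2) < z.1 ∧ z.1 < c * t ∧
    (z.1 - c * t) / Real.sqrt 3 < z.2 ∧ z.2 < (c * t - z.1) / Real.sqrt 3}

/-- The interior of the simplex `{s, r ≥ 0, s + r ≤ t}`. -/
def openSimplex (t : ℝ) : Set (ℝ × ℝ) :=
  {z | 0 < z.1 ∧ 0 < z.2 ∧ z.1 + z.2 < t}

/-- `f` is a probability density of the random vector `Z` in the planar region `U`:
`P(Z ∈ B) = ∫∫_B f(x, y) dx dy` for every Borel set `B ⊆ U`. -/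
def IsDensityOn {Ω : Type*} [MeasurableSpace Ω] (P : Measure Ω) (Z : Ω → ℝ × ℝ)
    (U : Set (ℝ × ℝ)) (f : ℝ → ℝ → ℝ) : Prop :=
  Measurable (Function.uncurry f) ∧ (∀ z ∈ U, 0 ≤ f z.1 z.2) ∧
    ∀ B : Set (ℝ × ℝ), MeasurableSet B → B ⊆ U →
      P (Z ⁻¹' B) = ∫⁻ z in B, ENNReal.ofReal (f z.1 z.2)

/-- `q t x y` is the transition density of the planar motion with current direction `D`: at every
time `t > 0`, it is the density of the position in the interior of its triangular support. -/
def IsTransitionDensity {Ω : Type*} [MeasurableSpace Ω] (P : Measure Ω) (c : ℝ)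
    (D : ℝ → Ω → Fin 3) (q : ℝ → ℝ → ℝ → ℝ) : Prop :=
  ∀ t, 0 < t → IsDensityOn P (planarPosition c D t) (openTriangle c t) (q t)

/-! Forgetting the orientation of a direction in `ℝ³` leaves its axis. From any of the six
directions, the probability that the next one lies on a given axis depends only on the current axis.
The axis therefore follows the three-state rule: uniform on the two other axes for the OSM, uniform
on all three for the OUM (`IsDirectionOfMotion.lump`). This is the rule of the planar motion, with
the same rate function.

The rule and the rate determine the finite-dimensional laws. On a time grid the counts are
independent Poisson variables, and given the counts the directions have Markov path weights
(`IsDirectionOfMotion.measure_eq_of_finset`). Paths are right-constant, so occupation times are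
limits of Riemann sums, and their joint laws agree as well (`IsDirectionOfMotion.map_occPair_eq`).
The three times add up to `t`, because every instant belongs to exactly one axis.

The planar position is the sum of the velocities weighted by the occupation times. Eliminating the
third time makes it an invertible affine function of the first two (`planarPosition_eq`), with
determinant `3√3c²/2`; this gives the formula for the density
(`IsDirectionOfMotion.isDensityOn_occPair`).

Existence of the density is the longer part. In the open simplex all three states are visited, which
forces two changes of state with different unordered pairs (`exists_two_changes`). On a fine
rational grid these occupy two cells with a single event each. Given such cells, the two event times
are independent of each other and of the process with the cells skipped, and have laws proportional
to `lam` (`map_jumpEvent_eq_prod`). Moving the two events shifts the pair of occupation times by an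
invertible linear map, so a null set has probability zero on each of these countably many events
(`IsDirectionOfMotion.measure_occPair_eq_zero`). Radon–Nikodym then yields the density. -/

/-! ### Counting events -/

section EventCounts

variable {Ω : Type*} {Γ : Ω → Set ℝ} {ω : Ω} {s t u : ℝ}

theorem eventCount_self (Γ : Ω → Set ℝ) (s : ℝ) (ω : Ω) : eventCount Γ s s ω = 0 := by
  simp [eventCount]

theorem eventCount_add (hfin : (Γ ω ∩ Ioc s u).Finite) (hst : s ≤ t) (htu : t ≤ u) :
    eventCount Γ s u ω = eventCount Γ s t ω + eventCount Γ t u ω := by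
  unfold eventCount
  rw [← Ioc_union_Ioc_eq_Ioc hst htu, inter_union_distrib_left]
  refine ncard_union_eq ?_ (hfin.subset ?_) (hfin.subset ?_)
  · exact (Ioc_disjoint_Ioc_of_le le_rfl).mono inter_subset_right inter_subset_right
  · exact inter_subset_inter_right _ (Ioc_subset_Ioc_right htu)
  · exact inter_subset_inter_right _ (Ioc_subset_Ioc_left hst)

theorem eventCount_eq_zero_iff (hfin : (Γ ω ∩ Ioc s t).Finite) :
    eventCount Γ s t ω = 0 ↔ Γ ω ∩ Ioc s t = ∅ :=
  ncard_eq_zero hfin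

/-- A discrete intermediate value property: the count grows by exactly one at the first event after
a given time. -/
theorem exists_eventCount_eq (hfin : (Γ ω ∩ Ioc s t).Finite) (hst : s ≤ t) (k : ℕ)
    (hk : k ≤ eventCount Γ s t ω) : ∃ u ∈ Icc s t, eventCount Γ s u ω = k := by
  induction k with
  | zero => exact ⟨s, left_mem_Icc.2 hst, eventCount_self Γ s ω⟩
  | succ k ih =>
    obtain ⟨u, hu, huk⟩ := ih (by omega)
    have hadd := eventCount_add hfin hu.1 hu.2
    have hfu : (Γ ω ∩ Ioc u t).Finite :=
      hfin.subset (inter_subset_inter_right _ (Ioc_subset_Ioc_left hu.1))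
    have hne : (Γ ω ∩ Ioc u t).Nonempty := by
      rw [nonempty_iff_ne_empty, Ne, ← eventCount_eq_zero_iff hfu]
      omega
    obtain ⟨w, hw, hmin⟩ := hfu.exists_minimal hne
    refine ⟨w, ⟨hu.1.trans hw.2.1.le, hw.2.2⟩, ?_⟩
    have hone : Γ ω ∩ Ioc u w = {w} := by
      ext z
      simp only [mem_inter_iff, mem_Ioc, mem_singleton_iff]
      constructor
      · rintro ⟨h1, h2, h3⟩
        exact le_antisymm h3 (hmin ⟨h1, h2, h3.trans hw.2.2⟩ h3)
      · rintro rfl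
        exact ⟨hw.1, hw.2.1, le_rfl⟩
    rw [eventCount_add (hfin.subset (inter_subset_inter_right _ (Ioc_subset_Ioc_right hw.2.2)))
      hu.1 hw.2.1.le, huk]
    simp [eventCount, hone]

/-- After every positive time there is a short interval without events. -/
theorem exists_forall_Ioc_eq_empty (hfin : ∀ s t, 0 < s → (Γ ω ∩ Ioc s t).Finite) (hu : 0 < u) :
    ∃ ε > 0, ∀ v < u + ε, Γ ω ∩ Ioc u v = ∅ := by
  rcases (Γ ω ∩ Ioc u (u + 1)).eq_empty_or_nonempty with h | h
  · refine ⟨1, one_pos, fun v hv => ?_⟩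
    exact subset_empty_iff.1
      (h ▸ inter_subset_inter_right _ (Ioc_subset_Ioc_right hv.le))
  · obtain ⟨w, hw, hmin⟩ := (hfin u (u + 1) hu).exists_minimal h
    refine ⟨w - u, sub_pos.2 hw.2.1, fun v hv => ?_⟩
    rw [eq_empty_iff_forall_notMem]
    rintro z ⟨h1, h2, h3⟩
    have hzw : z < w := by linarith
    exact absurd (hmin ⟨h1, h2, (hzw.trans_le hw.2.2).le⟩ hzw.le) (not_le.2 hzw)

theorem measurableSet_eventSigma (hs : 0 < s) (n : ℕ) :
    MeasurableSet[eventSigma Γ] {ω | eventCount Γ s t ω = n} :=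
  MeasurableSpace.measurableSet_generateFrom ⟨s, t, n, hs, rfl⟩

variable [MeasurableSpace Ω] {P : Measure Ω} {lam : ℝ → ℝ}

theorem IsPoissonEvents.eventSigma_le (h : IsPoissonEvents P lam Γ) :
    eventSigma Γ ≤ ‹MeasurableSpace Ω› := by
  refine MeasurableSpace.generateFrom_le ?_
  rintro _ ⟨s, t, n, hs, rfl⟩
  exact h.measurable_count s t hs (measurableSet_singleton n)

end EventCounts

/-! ### Path weights of the Markov chain and lumping -/

section Paths

variable {ι : Type*}

/-- The extension of a finite path to a sequence. -/
def pathExt {n : ℕ} (e : Fin (n + 1) → ι) (k : ℕ) : ι :=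
  e ⟨min k n, Nat.lt_succ_of_le (min_le_right k n)⟩

theorem pathExt_val {n : ℕ} (e : Fin (n + 1) → ι) (k : Fin (n + 1)) : pathExt e k = e k := by
  unfold pathExt
  congr 1
  ext
  simp [Nat.le_of_lt_succ k.2]

theorem pathExt_snoc_of_le {n : ℕ} (e : Fin (n + 1) → ι) (j : ι) {k : ℕ} (hk : k ≤ n) :
    pathExt (Fin.snoc e j : Fin (n + 2) → ι) k = pathExt e k := by
  have h1 := pathExt_val (Fin.snoc e j : Fin (n + 2) → ι) (Fin.castSucc ⟨k, Nat.lt_succ_of_le hk⟩)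
  have h2 := pathExt_val e ⟨k, Nat.lt_succ_of_le hk⟩
  rw [Fin.snoc_castSucc] at h1
  exact h1.trans h2.symm

theorem pathExt_snoc_last {n : ℕ} (e : Fin (n + 1) → ι) (j : ι) :
    pathExt (Fin.snoc e j : Fin (n + 2) → ι) (n + 1) = j := by
  have h1 := pathExt_val (Fin.snoc e j : Fin (n + 2) → ι) (Fin.last (n + 1))
  rw [Fin.snoc_last] at h1
  exact h1

variable [Fintype ι]

/-- The probability that the Markov chain with uniform initial law and transition matrix
`uniformChoice A` has a path of length `n` with the property `Q`. -/
noncomputable def pathWeight (A : ι → Finset ι) (n : ℕ) (Q : (ℕ → ι) → Prop) : ℝ :=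
  ∑ e : Fin (n + 1) → ι, if Q (pathExt e) then
    (1 / (Fintype.card ι : ℝ)) *
      ∏ k ∈ Finset.range n, uniformChoice A (pathExt e k) (pathExt e (k + 1)) else 0

/-- The image of the Markov chain under a map that is compatible with the transition rules. -/
theorem pathWeight_lift {κ : Type*} [Fintype κ] (A : ι → Finset ι) (A' : κ → Finset κ)
    (φ : ι → κ)
    (hinit : ∀ b, ∑ i, (if φ i = b then 1 / (Fintype.card ι : ℝ) else 0)
      = 1 / (Fintype.card κ : ℝ))
    (hstep : ∀ i b, ∑ j, (if φ j = b then uniformChoice A i j else 0)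
      = uniformChoice A' (φ i) b) (n : ℕ) (e' : ℕ → κ) :
    pathWeight A n (fun e => ∀ k ≤ n, φ (e k) = e' k)
      = (1 / (Fintype.card κ : ℝ)) * ∏ k ∈ Finset.range n, uniformChoice A' (e' k) (e' (k + 1)) := by
  induction n with
  | zero =>
    rw [← hinit (e' 0)]
    unfold pathWeight
    rw [← (Equiv.funUnique (Fin 1) ι).symm.sum_comp]
    simp [pathExt]
  | succ n ih =>
    rw [Finset.prod_range_succ, ← mul_assoc, ← ih]
    unfold pathWeight
    rw [← (Fin.snocEquiv (fun _ : Fin (n + 2) => ι)).sum_comp, Fintype.sum_prod_type_right,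
      Finset.sum_mul]
    refine Finset.sum_congr rfl fun e _ => ?_
    simp only [Fin.snocEquiv, Equiv.coe_fn_mk]
    have hQ : ∀ j, (∀ k ≤ n + 1, φ (pathExt (Fin.snoc e j : Fin (n + 2) → ι) k) = e' k) ↔
        (∀ k ≤ n, φ (pathExt e k) = e' k) ∧ φ j = e' (n + 1) := by
      intro j
      constructor
      · intro h
        refine ⟨fun k hk => ?_, ?_⟩
        · rw [← h k (by omega), pathExt_snoc_of_le e j hk]
        · rw [← h (n + 1) le_rfl, pathExt_snoc_last]
      · rintro ⟨h1, h2⟩ k hk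
        rcases Nat.lt_or_ge k (n + 1) with hk' | hk'
        · rw [pathExt_snoc_of_le e j (by omega), h1 k (by omega)]
        · rw [le_antisymm hk hk', pathExt_snoc_last, h2]
    have hprod : ∀ j, ∏ k ∈ Finset.range (n + 1),
        uniformChoice A (pathExt (Fin.snoc e j : Fin (n + 2) → ι) k)
          (pathExt (Fin.snoc e j : Fin (n + 2) → ι) (k + 1))
        = (∏ k ∈ Finset.range n, uniformChoice A (pathExt e k) (pathExt e (k + 1))) *
          uniformChoice A (pathExt e n) j := by
      intro j
      rw [Finset.prod_range_succ, pathExt_snoc_last, pathExt_snoc_of_le e j le_rfl]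
      congr 1
      refine Finset.prod_congr rfl fun k hk => ?_
      have := Finset.mem_range.1 hk
      rw [pathExt_snoc_of_le e j (by omega), pathExt_snoc_of_le e j (by omega)]
    simp only [hQ, hprod]
    by_cases hall : ∀ k ≤ n, φ (pathExt e k) = e' k
    · simp only [and_iff_right hall, if_pos hall]
      -- Strong lumpability: the total weight of the last steps into a class depends on the last
      -- state only through its own class, so it factors out of the sum over shorter paths.
      rw [← hall n le_rfl, ← hstep, Finset.mul_sum]
      refine Finset.sum_congr rfl fun j _ => ?_
      split_ifs <;> ring
    · simp [hall]

end Paths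

/-! ### The direction process between two positive times -/

section DirectionProcess

variable {Ω ι : Type*} [MeasurableSpace Ω] [Fintype ι] {P : Measure Ω} {A : ι → Finset ι}
  {lam : ℝ → ℝ} {Γ : Ω → Set ℝ} {D : ℝ → Ω → ι} {s t : ℝ}

namespace IsDirectionOfMotion

theorem finite_events (h : IsDirectionOfMotion P A lam Γ D) (ω : Ω) (s t : ℝ) (hs : 0 < s) :
    (Γ ω ∩ Ioc s t).Finite :=
  h.poisson.locallyFinite ω s t hs

theorem direction_eq_of_eventCount_eq (h : IsDirectionOfMotion P A lam Γ D) {ω : Ω} {u v : ℝ}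
    (hs : 0 < s) (hu : s ≤ u) (hv : s ≤ v) (huv : eventCount Γ s u ω = eventCount Γ s v ω) :
    D u ω = D v ω := by
  wlog hle : u ≤ v generalizing u v
  · exact (this hv hu huv.symm (le_of_not_ge hle)).symm
  have hadd := eventCount_add (h.finite_events ω s v hs) hu hle
  have h0 : eventCount Γ u v ω = 0 := by omega
  rw [eventCount_eq_zero_iff (h.finite_events ω u v (hs.trans_le hu))] at h0
  exact (h.const_between ω u v (hs.trans_le hu) hle h0).symm

/-- Each count up to `n` is attained at some time, and the direction there does not depend on which
such time is chosen. -/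
theorem exists_path (h : IsDirectionOfMotion P A lam Γ D) {ω : Ω} (hs : 0 < s) (hst : s ≤ t)
    {n : ℕ} (hn : eventCount Γ s t ω = n) :
    ∃ e : Fin (n + 1) → ι, ∀ u ∈ Icc s t, D u ω = pathExt e (eventCount Γ s u ω) := by
  have hex : ∀ k : Fin (n + 1), ∃ u ∈ Icc s t, eventCount Γ s u ω = k := fun k =>
    exists_eventCount_eq (h.finite_events ω s t hs) hst k (by omega)
  choose u hu huk using hex
  refine ⟨fun k => D (u k) ω, fun v hv => ?_⟩
  refine h.direction_eq_of_eventCount_eq hs hv.1 (hu _).1 ?_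
  rw [huk]
  have := eventCount_add (h.finite_events ω s t hs) hv.1 hv.2
  simp only
  omega

theorem path_unique (h : IsDirectionOfMotion P A lam Γ D) {ω : Ω} (hs : 0 < s) (hst : s ≤ t)
    {n : ℕ} (hn : eventCount Γ s t ω = n) {e e' : ℕ → ι}
    (he : ∀ u ∈ Icc s t, D u ω = e (eventCount Γ s u ω))
    (he' : ∀ u ∈ Icc s t, D u ω = e' (eventCount Γ s u ω)) {k : ℕ} (hk : k ≤ n) :
    e k = e' k := by
  obtain ⟨u, hu, huk⟩ := exists_eventCount_eq (h.finite_events ω s t hs) hst k (by omega)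
  rw [← huk, ← he u hu, he' u hu]

theorem exists_forall_direction_eq (h : IsDirectionOfMotion P A lam Γ D) (ω : Ω) {u : ℝ}
    (hu : 0 < u) : ∃ ε > 0, ∀ v ∈ Ico u (u + ε), D v ω = D u ω := by
  obtain ⟨ε, hε, hv⟩ := exists_forall_Ioc_eq_empty (h.finite_events ω) hu
  exact ⟨ε, hε, fun v hv' => h.const_between ω u v hu hv'.1 (hv v hv'.2)⟩

/-- Direction and count are both constant on a short interval to the right of any time, so rational
times suffice. The end point `t`, which has no rational time to its right in the interval, is added
separately. -/
theorem measurableSet_path (h : IsDirectionOfMotion P A lam Γ D) (hs : 0 < s) (hst : s < t)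
    (e : ℕ → ι) :
    MeasurableSet {ω | ∀ u ∈ Icc s t, D u ω = e (eventCount Γ s u ω)} := by
  have heq : {ω | ∀ u ∈ Icc s t, D u ω = e (eventCount Γ s u ω)} =
      ⋂ q ∈ insert t (Icc s t ∩ range ((↑) : ℚ → ℝ)),
        {ω | D q ω = e (eventCount Γ s q ω)} := by
    ext ω
    simp only [mem_ofPred_eq, mem_iInter]
    constructor
    · rintro hω q (rfl | hq)
      · exact hω q (right_mem_Icc.2 hst.le)
      · exact hω q hq.1
    · intro hω u hu
      rcases hu.2.eq_or_lt with rfl | hut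
      · exact hω u (mem_insert _ _)
      have hu0 : 0 < u := hs.trans_le hu.1
      obtain ⟨ε, hε, hv⟩ := exists_forall_Ioc_eq_empty (h.finite_events ω) hu0
      obtain ⟨q, hq1, hq2⟩ := exists_rat_btwn (lt_min hut (lt_add_of_pos_right u hε))
      have hemp := hv q (hq2.trans_le (min_le_right _ _))
      have hqt : (q : ℝ) < t := hq2.trans_le (min_le_left _ _)
      have h1 := h.const_between ω u q hu0 hq1.le hemp
      have h2 := eventCount_add (h.finite_events ω s q hs) hu.1 hq1.le
      rw [(eventCount_eq_zero_iff (h.finite_events ω u q hu0)).2 hemp, add_zero] at h2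
      rw [← h1, ← h2]
      exact hω q (mem_insert_of_mem _ ⟨⟨hu.1.trans hq1.le, hqt.le⟩, q, rfl⟩)
  rw [heq]
  refine MeasurableSet.biInter
    (((countable_range _).mono inter_subset_right).insert t) fun q hq => ?_
  have hq0 : 0 < q := by
    rcases hq with rfl | hq
    · exact hs.trans hst
    · exact hs.trans_le hq.1.1
  have : {ω | D q ω = e (eventCount Γ s q ω)} =
      ⋃ i : ι, {ω | D q ω = i} ∩ eventCount Γ s q ⁻¹' {n | e n = i} := by
    ext ω
    simp [eq_comm]
  rw [this]
  exact MeasurableSet.iUnion fun i => (h.measurable_direction q hq0 i).inter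
    (h.poisson.measurable_count s q hs (.of_discrete))

/-- Given the event times, the probability of a property of the directions taken in `[s, t]` is
the probability of the corresponding property of the Markov chain. -/
theorem measureReal_inter_eq_pathWeight [IsFiniteMeasure P] (h : IsDirectionOfMotion P A lam Γ D)
    (hs : 0 < s) (hst : s < t) {n : ℕ} {Q : (ℕ → ι) → Prop} {B S : Set Ω}
    (hB : MeasurableSet[eventSigma Γ] B) (hBn : ∀ ω ∈ B, eventCount Γ s t ω = n)
    (hS : ∀ ω ∈ B, ∀ e : ℕ → ι, (∀ u ∈ Icc s t, D u ω = e (eventCount Γ s u ω)) →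
      (ω ∈ S ↔ Q e)) :
    P.real (S ∩ B) = pathWeight A n Q * P.real B := by
  have hBm : MeasurableSet B := h.poisson.eventSigma_le _ hB
  let G : (Fin (n + 1) → ι) → Set Ω := fun e =>
    if Q (pathExt e) then
      {ω | ∀ u ∈ Icc s t, D u ω = pathExt e (eventCount Γ s u ω)} ∩ B else ∅
  have hunion : S ∩ B = ⋃ e, G e := by
    ext ω
    simp only [G, mem_inter_iff, mem_iUnion]
    constructor
    · rintro ⟨h1, h2⟩
      obtain ⟨e, he⟩ := h.exists_path hs hst.le (hBn ω h2)
      refine ⟨e, ?_⟩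
      rw [if_pos ((hS ω h2 _ he).1 h1)]
      exact ⟨he, h2⟩
    · rintro ⟨e, he⟩
      split_ifs at he with hQ
      · exact ⟨(hS ω he.2 _ he.1).2 hQ, he.2⟩
      · exact absurd he (notMem_empty _)
  have hdisj : Pairwise (Function.onFun Disjoint G) := by
    intro e e' hne
    rw [Function.onFun, Set.disjoint_left]
    intro ω h1 h2
    simp only [G] at h1 h2
    split_ifs at h1 h2
    · refine hne (funext fun k => ?_)
      have := h.path_unique hs hst.le (hBn ω h1.2) h1.1 h2.1 (Nat.le_of_lt_succ k.2)
      rwa [pathExt_val, pathExt_val] at this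
    all_goals simp_all
  have hmeas : ∀ e, MeasurableSet (G e) := by
    intro e
    simp only [G]
    split_ifs
    · exact (h.measurableSet_path hs hst _).inter hBm
    · exact MeasurableSet.empty
  rw [hunion, measureReal_iUnion_fintype hdisj hmeas, pathWeight, Finset.sum_mul]
  refine Finset.sum_congr rfl fun e _ => ?_
  simp only [G]
  split_ifs with hQ
  · have h1 : {ω | ∀ u ∈ Icc s t, D u ω = pathExt e (eventCount Γ s u ω)} ∩ B =
        {ω | eventCount Γ s t ω = n ∧
          ∀ u ∈ Icc s t, D u ω = pathExt e (eventCount Γ s u ω)} ∩ B := by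
      ext ω
      simp only [mem_inter_iff, mem_ofPred_eq]
      constructor
      · rintro ⟨h1, h2⟩
        exact ⟨⟨hBn ω h2, h1⟩, h2⟩
      · rintro ⟨⟨-, h1⟩, h2⟩
        exact ⟨h1, h2⟩
    have h2 : {ω | eventCount Γ s t ω = n} ∩ B = B := inter_eq_right.2 hBn
    rw [h1, h.chain s t hs hst n _ B hB, h2]
  · simp

/-- The image of the direction process under a map that is compatible with the transition rules
is a direction process. -/
theorem lump [IsFiniteMeasure P] {κ : Type*} [Fintype κ] {A' : κ → Finset κ}
    (h : IsDirectionOfMotion P A lam Γ D) (φ : ι → κ)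
    (hinit : ∀ b, ∑ i, (if φ i = b then 1 / (Fintype.card ι : ℝ) else 0)
      = 1 / (Fintype.card κ : ℝ))
    (hstep : ∀ i b, ∑ j, (if φ j = b then uniformChoice A i j else 0)
      = uniformChoice A' (φ i) b) :
    IsDirectionOfMotion P A' lam Γ (fun t ω => φ (D t ω)) where
  poisson := h.poisson
  measurable_direction t ht b := by
    have : {ω | φ (D t ω) = b} = ⋃ i ∈ {i | φ i = b}, {ω | D t ω = i} := by
      ext ω
      simp
    rw [this]
    exact MeasurableSet.biUnion (to_countable _) fun i _ => h.measurable_direction t ht i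
  const_between ω s t hs hst he := by rw [h.const_between ω s t hs hst he]
  chain s t hs hst n e B hB := by
    have hB' : MeasurableSet[eventSigma Γ] ({ω | eventCount Γ s t ω = n} ∩ B) :=
      (measurableSet_eventSigma hs n).inter hB
    rw [← pathWeight_lift A A' φ hinit hstep,
      ← h.measureReal_inter_eq_pathWeight (S := {ω | eventCount Γ s t ω = n ∧
          ∀ u ∈ Icc s t, φ (D u ω) = e (eventCount Γ s u ω)}) hs hst hB' (fun ω hω => hω.1)]
    · congr 1
      ext ω
      simp only [mem_inter_iff, mem_ofPred_eq]
      tauto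
    · intro ω hω e₀ he₀
      simp only [mem_ofPred_eq]
      constructor
      · rintro ⟨h1, h2⟩ k hk
        obtain ⟨u, hu, huk⟩ := exists_eventCount_eq (h.finite_events ω s t hs) hst.le k
          (by rw [h1]; exact hk)
        rw [← huk, ← he₀ u hu, h2 u hu]
      · intro h2
        refine ⟨hω.1, fun u hu => ?_⟩
        rw [he₀ u hu]
        refine h2 _ ?_
        have := eventCount_add (h.finite_events ω s t hs) hu.1 hu.2
        have := hω.1
        simp only [mem_ofPred_eq] at this
        omega

end IsDirectionOfMotion

end DirectionProcess

/-! ### Event counts on finite time grids -/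

section Grids

/-- `v 0 < ⋯ < v m` are positive times. -/
structure IsGrid (v : ℕ → ℝ) (m : ℕ) : Prop where
  mono : Monotone v
  strict : ∀ j k, k ≤ m → j < k → v j < v k
  pos : 0 < v 0
  m_pos : 0 < m

theorem exists_isGrid (V : Finset ℝ) (hpos : ∀ u ∈ V, 0 < u) (hcard : 1 < V.card) :
    ∃ (m : ℕ) (v : ℕ → ℝ), IsGrid v m ∧ ∀ u, u ∈ V ↔ ∃ j ≤ m, v j = u := by
  obtain ⟨m, hm⟩ : ∃ m, V.card = m + 1 := ⟨V.card - 1, by omega⟩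
  let f := V.orderEmbOfFin hm
  -- Constant from index `m` on: independence of counts is formulated for monotone sequences indexed
  -- by all of `ℕ`, while strictness is needed only up to `m`.
  let v : ℕ → ℝ := fun k => f ⟨min k m, Nat.lt_succ_of_le (min_le_right k m)⟩
  refine ⟨m, v, ⟨?_, ?_, ?_, by omega⟩, fun u => ?_⟩
  · intro j k hjk
    exact f.monotone (Fin.mk_le_mk.2 (min_le_min_right m hjk))
  · intro j k hk hjk
    exact f.strictMono (Fin.mk_lt_mk.2 (by omega))
  · exact hpos _ (V.orderEmbOfFin_mem hm _)
  · constructor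
    · intro hu
      rw [← Finset.mem_coe, ← V.range_orderEmbOfFin hm] at hu
      obtain ⟨j, rfl⟩ := hu
      refine ⟨j, by omega, ?_⟩
      simp only [v, f]
      congr 1
      ext
      simp only
      omega
    · rintro ⟨j, -, rfl⟩
      exact V.orderEmbOfFin_mem hm _

/-- The number of events in `(v 0, u]` if there are `n k` events in the cell `(v k, v (k + 1)]`. -/
noncomputable def gridCount (v : ℕ → ℝ) {m : ℕ} (n : Fin m → ℕ) (u : ℝ) : ℕ :=
  ∑ k : Fin m, if v k < u then n k else 0

/-- There are `n k` events in the cell `(v k, v (k + 1)]`. -/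
def cellEvent {Ω : Type*} (Γ : Ω → Set ℝ) (v : ℕ → ℝ) {m : ℕ} (n : Fin m → ℕ) : Set Ω :=
  {ω | ∀ k : Fin m, eventCount Γ (v k) (v (k + 1)) ω = n k}

variable {Ω : Type*} {Γ : Ω → Set ℝ} {v : ℕ → ℝ} {m : ℕ}

theorem IsGrid.eventCount_eq_sum (hv : IsGrid v m) {ω : Ω}
    (hfin : ∀ s t, 0 < s → (Γ ω ∩ Ioc s t).Finite) (j : ℕ) :
    eventCount Γ (v 0) (v j) ω = ∑ k ∈ Finset.range j, eventCount Γ (v k) (v (k + 1)) ω := by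
  induction j with
  | zero => simp [eventCount_self]
  | succ j ih =>
    rw [Finset.sum_range_succ, ← ih]
    exact eventCount_add (hfin _ _ hv.pos) (hv.mono (Nat.zero_le j)) (hv.mono (Nat.le_succ j))

theorem IsGrid.eventCount_eq_gridCount (hv : IsGrid v m) {ω : Ω}
    (hfin : ∀ s t, 0 < s → (Γ ω ∩ Ioc s t).Finite) {n : Fin m → ℕ} (hω : ω ∈ cellEvent Γ v n)
    {j : ℕ} (hj : j ≤ m) : eventCount Γ (v 0) (v j) ω = gridCount v n (v j) := by
  have h1 : gridCount v n (v j) = ∑ k : Fin m,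
      (fun k : ℕ => if v k < v j then eventCount Γ (v k) (v (k + 1)) ω else 0) k := by
    refine Finset.sum_congr rfl fun k _ => ?_
    rw [← hω k]
  rw [h1, Fin.sum_univ_eq_sum_range
    (fun k : ℕ => if v k < v j then eventCount Γ (v k) (v (k + 1)) ω else 0) m,
    hv.eventCount_eq_sum hfin, ← Finset.sum_filter]
  refine Finset.sum_congr ?_ fun _ _ => rfl
  ext k
  simp only [Finset.mem_range, Finset.mem_filter]
  constructor
  · intro hk
    exact ⟨by omega, hv.strict k j hj hk⟩
  · rintro ⟨-, hk⟩
    by_contra hjk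
    exact absurd (hv.mono (not_lt.1 hjk)) (not_le.2 hk)

theorem IsGrid.measurableSet_cellEvent (hv : IsGrid v m) (n : Fin m → ℕ) :
    MeasurableSet[eventSigma Γ] (cellEvent Γ v n) := by
  have : cellEvent Γ v n = ⋂ k : Fin m, {ω | eventCount Γ (v k) (v (k + 1)) ω = n k} := by
    ext ω
    simp [cellEvent]
  rw [this]
  exact MeasurableSet.iInter fun k =>
    measurableSet_eventSigma (hv.pos.trans_le (hv.mono (Nat.zero_le _))) _

/-- The only grid point separating two adjacent cells is their common end point `v k₁`; at every
other grid point either both cells have been counted or neither has. -/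
theorem IsGrid.gridCount_swap (hv : IsGrid v m) {k₀ k₁ : Fin m} (hk : (k₁ : ℕ) = k₀ + 1) {j : ℕ}
    (hj : j ≤ m) (hjk : j ≠ k₁) (n : Fin m → ℕ) :
    gridCount v (n ∘ Equiv.swap k₀ k₁) (v j) = gridCount v n (v j) := by
  have hiff : v k₀ < v j ↔ v k₁ < v j := by
    constructor
    · intro hlt
      refine hv.strict _ _ hj ?_
      by_contra hle
      exact absurd (hv.mono (show j ≤ k₀ by omega)) (not_le.2 hlt)
    · exact fun hlt => (hv.mono (by omega)).trans_lt hlt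
  unfold gridCount
  rw [← Equiv.sum_comp (Equiv.swap k₀ k₁)]
  refine Finset.sum_congr rfl fun k _ => ?_
  simp only [Function.comp, Equiv.swap_apply_self]
  rcases eq_or_ne k k₀ with rfl | hk0
  · simp [hiff]
  rcases eq_or_ne k k₁ with rfl | hk1
  · simp [hiff]
  · rw [Equiv.swap_apply_of_ne_of_ne hk0 hk1]

variable [MeasurableSpace Ω] {P : Measure Ω} {lam : ℝ → ℝ}

theorem IsPoissonEvents.measure_eventCount_eq (h : IsPoissonEvents P lam Γ) {s t : ℝ} (hs : 0 < s)
    (hst : s ≤ t) (n : ℕ) : P (eventCount Γ s t ⁻¹' {n}) =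
      poissonMeasure (∫ u in s..t, lam u).toNNReal {n} := by
  rw [← h.count_law s t hs hst,
    Measure.map_apply (h.measurable_count s t hs) (measurableSet_singleton n)]

theorem IsPoissonEvents.measure_cellEvent (h : IsPoissonEvents P lam Γ) (hv : IsGrid v m)
    (n : Fin m → ℕ) : P (cellEvent Γ v n) =
      ∏ k : Fin m, poissonMeasure (∫ u in v k..v (k + 1), lam u).toNNReal {n k} := by
  have hind := (h.indep_counts v hv.pos hv.mono).precomp (Fin.val_injective (n := m))
  have heq : cellEvent Γ v n = ⋂ k ∈ (Finset.univ : Finset (Fin m)),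
      (fun k : Fin m => eventCount Γ (v k) (v (k + 1))) k ⁻¹' {n k} := by
    ext ω
    simp [cellEvent]
  rw [heq, hind.measure_inter_preimage_eq_mul Finset.univ
    (fun k _ => measurableSet_singleton (n k))]
  exact Finset.prod_congr rfl fun k _ => h.measure_eventCount_eq
    (hv.pos.trans_le (hv.mono (Nat.zero_le _))) (hv.mono (Nat.le_succ _)) _

theorem IsPoissonEvents.measure_eq_tsum (h : IsPoissonEvents P lam Γ) (hv : IsGrid v m)
    (S : Set Ω) : P S = ∑' n : Fin m → ℕ, P (S ∩ cellEvent Γ v n) := by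
  let N : Ω → Fin m → ℕ := fun ω k => eventCount Γ (v k) (v (k + 1)) ω
  have hN : ∀ n, N ⁻¹' {n} = cellEvent Γ v n := by
    intro n
    ext ω
    simp [N, cellEvent, funext_iff]
  have hm : ∀ n, MeasurableSet (N ⁻¹' {n}) := by
    intro n
    rw [hN]
    exact h.eventSigma_le _ (hv.measurableSet_cellEvent n)
  -- Passing to the restricted measure requires measurability of the cells only, not of `S`.
  have h1 := measure_iUnion (μ := P.restrict S) (f := fun n => N ⁻¹' {n})
    (fun n n' hne => Disjoint.preimage N (by simpa using hne)) hm
  have h2 : ⋃ n, N ⁻¹' {n} = univ := by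
    ext ω
    simp
  rw [h2, Measure.restrict_apply_univ] at h1
  rw [h1]
  refine tsum_congr fun n => ?_
  rw [Measure.restrict_apply (hm n), hN, inter_comm]

end Grids

/-! ### Finite-dimensional laws and the position of a single event -/

section FiniteDimensional

variable {Ω ι : Type*} [MeasurableSpace Ω] [Fintype ι] {P : Measure Ω} {A : ι → Finset ι}
  {lam : ℝ → ℝ} {Γ : Ω → Set ℝ} {D : ℝ → Ω → ι}

namespace IsDirectionOfMotion

/-- The joint law of the directions and the numbers of events on a grid. -/
theorem measureReal_inter_cellEvent [IsFiniteMeasure P] (h : IsDirectionOfMotion P A lam Γ D)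
    {v : ℕ → ℝ} {m : ℕ} (hv : IsGrid v m) {K : (ℝ → ι) → Prop}
    (hK : ∀ d d' : ℝ → ι, (∀ j ≤ m, d (v j) = d' (v j)) → (K d ↔ K d')) (n : Fin m → ℕ) :
    P.real ({ω | K fun u => D u ω} ∩ cellEvent Γ v n) =
      pathWeight A (gridCount v n (v m)) (fun e => K fun u => e (gridCount v n u)) *
        P.real (cellEvent Γ v n) := by
  refine h.measureReal_inter_eq_pathWeight hv.pos (hv.strict 0 m le_rfl hv.m_pos)
    (hv.measurableSet_cellEvent n)
    (fun ω hω => hv.eventCount_eq_gridCount (h.finite_events ω) hω le_rfl) ?_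
  intro ω hω e he
  refine hK _ _ fun j hj => ?_
  rw [← hv.eventCount_eq_gridCount (h.finite_events ω) hω hj]
  exact he _ ⟨hv.mono (Nat.zero_le j), hv.mono hj⟩

/-- The finite-dimensional distributions of the direction process are determined by the transition
rule and the rate function. -/
theorem measure_eq_of_finset [IsFiniteMeasure P] {Ω' : Type*} [MeasurableSpace Ω']
    {P' : Measure Ω'} [IsFiniteMeasure P'] {Γ' : Ω' → Set ℝ} {D' : ℝ → Ω' → ι}
    (h : IsDirectionOfMotion P A lam Γ D) (h' : IsDirectionOfMotion P' A lam Γ' D')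
    {U : Finset ℝ} (hU : ∀ u ∈ U, 0 < u) {K : (ℝ → ι) → Prop}
    (hK : ∀ d d' : ℝ → ι, (∀ u ∈ U, d u = d' u) → (K d ↔ K d')) :
    P {ω | K fun u => D u ω} = P' {ω | K fun u => D' u ω} := by
  -- The points `1` and `2` are arbitrary; they ensure that the grid has at least one cell even if
  -- `U` is empty.
  obtain ⟨m, v, hv, hvV⟩ := exists_isGrid (U ∪ {1, 2})
    (by simp only [Finset.mem_union, Finset.mem_insert, Finset.mem_singleton]
        rintro u (h | rfl | rfl)
        exacts [hU u h, one_pos, two_pos])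
    (Finset.one_lt_card.2 ⟨1, by simp, 2, by simp, by norm_num⟩)
  have hK' : ∀ d d' : ℝ → ι, (∀ j ≤ m, d (v j) = d' (v j)) → (K d ↔ K d') := by
    intro d d' hd
    refine hK d d' fun u hu => ?_
    obtain ⟨j, hj, rfl⟩ := (hvV u).1 (Finset.mem_union_left _ hu)
    exact hd j hj
  rw [h.poisson.measure_eq_tsum hv, h'.poisson.measure_eq_tsum hv]
  refine tsum_congr fun n => ?_
  rw [← measureReal_eq_measureReal_iff, h.measureReal_inter_cellEvent hv hK',
    h'.measureReal_inter_cellEvent hv hK', measureReal_def, measureReal_def,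
    h.poisson.measure_cellEvent hv, h'.poisson.measure_cellEvent hv]

/-- Moving a lone event into the next cell leaves the counts at all grid points except the common
end point unchanged. A property not looking at that point keeps its path weight, and only the
Poisson weights change, in the ratio of the two means. -/
theorem measure_cellEvent_swap [IsFiniteMeasure P] (h : IsDirectionOfMotion P A lam Γ D)
    {v : ℕ → ℝ} {m : ℕ} (hv : IsGrid v m) {k₀ k₁ : Fin m} (hk : (k₁ : ℕ) = k₀ + 1)
    {K : (ℝ → ι) → Prop}
    (hK : ∀ d d' : ℝ → ι, (∀ j ≤ m, j ≠ k₁ → d (v j) = d' (v j)) → (K d ↔ K d'))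
    {n : Fin m → ℕ} (hn₀ : n k₀ = 1) (hn₁ : n k₁ = 0)
    (h₀ : 0 ≤ ∫ u in v k₀..v (k₀ + 1), lam u) (h₁ : 0 ≤ ∫ u in v k₁..v (k₁ + 1), lam u) :
    P ({ω | K fun u => D u ω} ∩ cellEvent Γ v n) *
        ENNReal.ofReal (∫ u in v k₁..v (k₁ + 1), lam u) =
      P ({ω | K fun u => D u ω} ∩ cellEvent Γ v (n ∘ Equiv.swap k₀ k₁)) *
        ENNReal.ofReal (∫ u in v k₀..v (k₀ + 1), lam u) := by
  have hne : k₀ ≠ k₁ := by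
    intro heq
    rw [heq] at hk
    omega
  have hgc : ∀ j ≤ m, j ≠ k₁ →
      gridCount v (n ∘ Equiv.swap k₀ k₁) (v j) = gridCount v n (v j) :=
    fun j hj hjk => hv.gridCount_swap hk hj hjk n
  have hK' : ∀ d d' : ℝ → ι, (∀ j ≤ m, d (v j) = d' (v j)) → (K d ↔ K d') :=
    fun d d' hd => hK d d' fun j hj _ => hd j hj
  have hQ : (fun e : ℕ → ι => K fun u => e (gridCount v (n ∘ Equiv.swap k₀ k₁) u)) =
      fun e => K fun u => e (gridCount v n u) := by
    funext e
    refine propext (hK _ _ fun j hj hjk => ?_)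
    simp only [hgc j hj hjk]
  -- With means `α`, `β` of the two cells, the counts `(1, 0)` and `(0, 1)` have weights `α
  -- e^{-α-β}` and `β e^{-α-β}`; the other factors agree.
  have hP : P.real (cellEvent Γ v n) * (∫ u in v k₁..v (k₁ + 1), lam u) =
      P.real (cellEvent Γ v (n ∘ Equiv.swap k₀ k₁)) * ∫ u in v k₀..v (k₀ + 1), lam u := by
    simp only [measureReal_def, h.poisson.measure_cellEvent hv, ENNReal.toReal_prod]
    rw [← Finset.mul_prod_erase _ _ (Finset.mem_univ k₀),
      ← Finset.mul_prod_erase (Finset.univ.erase k₀) _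
        (Finset.mem_erase.2 ⟨hne.symm, Finset.mem_univ k₁⟩),
      ← Finset.mul_prod_erase Finset.univ _ (Finset.mem_univ k₀),
      ← Finset.mul_prod_erase (Finset.univ.erase k₀) _
        (Finset.mem_erase.2 ⟨hne.symm, Finset.mem_univ k₁⟩)]
    have hrest : ∏ k ∈ (Finset.univ.erase k₀).erase k₁,
        (poissonMeasure (∫ u in v k..v (k + 1), lam u).toNNReal
          {(n ∘ Equiv.swap k₀ k₁) k}).toReal =
        ∏ k ∈ (Finset.univ.erase k₀).erase k₁,
        (poissonMeasure (∫ u in v k..v (k + 1), lam u).toNNReal {n k}).toReal := by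
      refine Finset.prod_congr rfl fun k hk => ?_
      simp only [Finset.mem_erase] at hk
      rw [Function.comp, Equiv.swap_apply_of_ne_of_ne hk.2.1 hk.1]
    rw [hrest]
    simp only [Function.comp, Equiv.swap_apply_left, Equiv.swap_apply_right, hn₀, hn₁,
      ← measureReal_def, poissonMeasure_real_singleton, Real.coe_toNNReal _ h₀,
      Real.coe_toNNReal _ h₁]
    simp
    ring
  have hreal : P.real ({ω | K fun u => D u ω} ∩ cellEvent Γ v n) *
        (∫ u in v k₁..v (k₁ + 1), lam u) =
      P.real ({ω | K fun u => D u ω} ∩ cellEvent Γ v (n ∘ Equiv.swap k₀ k₁)) *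
        ∫ u in v k₀..v (k₀ + 1), lam u := by
    rw [h.measureReal_inter_cellEvent hv hK', h.measureReal_inter_cellEvent hv hK', hQ,
      hgc m le_rfl (by omega), mul_assoc, hP, mul_assoc]
  rw [← ofReal_measureReal, ← ofReal_measureReal, ← ENNReal.ofReal_mul measureReal_nonneg, hreal,
    ENNReal.ofReal_mul measureReal_nonneg]

/-- If there is exactly one event in `(a, b]`, its position is independent of the directions and
the numbers of events outside of this interval. -/
theorem measure_single_event [IsFiniteMeasure P] (h : IsDirectionOfMotion P A lam Γ D)
    (hint : ∀ s t, 0 < s → s ≤ t → IntervalIntegrable lam volume s t)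
    (hpos : ∀ t, 0 < t → 0 < lam t) {a x b : ℝ} (ha : 0 < a) (hax : a ≤ x) (hxb : x ≤ b)
    {U : Finset ℝ} (hU : ∀ u ∈ U, 0 < u) (hUab : ∀ u ∈ U, u ∉ Ioo a b) {K : (ℝ → ι) → Prop}
    (hK : ∀ d d' : ℝ → ι, (∀ u ∈ U, d u = d' u) → (K d ↔ K d'))
    (Q : Finset (ℝ × ℝ)) (hQpos : ∀ p ∈ Q, 0 < p.1 ∧ p.1 ≤ p.2)
    (hQab : ∀ p ∈ Q, p.2 ≤ a ∨ b ≤ p.1) :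
    P {ω | (K fun u => D u ω) ∧ (∀ p ∈ Q, eventCount Γ p.1 p.2 ω = 1) ∧
        eventCount Γ a b ω = 1 ∧ eventCount Γ a x ω = 1} * ENNReal.ofReal (∫ u in a..b, lam u) =
      P {ω | (K fun u => D u ω) ∧ (∀ p ∈ Q, eventCount Γ p.1 p.2 ω = 1) ∧
        eventCount Γ a b ω = 1} * ENNReal.ofReal (∫ u in a..x, lam u) := by
  have hcont : ∀ s t, 0 < s → s ≤ t → 0 ≤ ∫ u in s..t, lam u := fun s t hs hst =>
    intervalIntegral.integral_nonneg hst fun u hu => (hpos u (hs.trans_le hu.1)).le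
  rcases hax.eq_or_lt with rfl | hax
  · simp [eventCount_self]
  rcases hxb.eq_or_lt with rfl | hxb
  · congr 2
    ext ω
    simp
  obtain ⟨m, v, hv, hvV⟩ := exists_isGrid
    (U ∪ (Q.image Prod.fst ∪ Q.image Prod.snd) ∪ {a, x, b})
    (by
      intro u hu
      simp only [Finset.mem_union, Finset.mem_image, Finset.mem_insert,
        Finset.mem_singleton] at hu
      rcases hu with (hu | ⟨p, hp, rfl⟩ | ⟨p, hp, rfl⟩) | rfl | rfl | rfl
      · exact hU u hu
      · exact (hQpos p hp).1
      · exact (hQpos p hp).1.trans_le (hQpos p hp).2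
      all_goals linarith)
    (Finset.one_lt_card.2 ⟨a, by simp, x, by simp, hax.ne⟩)
  -- No grid point other than `x` lies strictly between `a` and `b`, so `a`, `x`, `b` are
  -- consecutive and bound two adjacent cells.
  have hvout : ∀ j ≤ m, v j ≤ a ∨ v j = x ∨ b ≤ v j := by
    intro j hj
    have hu := (hvV (v j)).2 ⟨j, hj, rfl⟩
    simp only [Finset.mem_union, Finset.mem_image, Finset.mem_insert,
      Finset.mem_singleton] at hu
    rcases hu with (hu | ⟨p, hp, hu⟩ | ⟨p, hp, hu⟩) | hu | hu | hu
    · by_contra hcon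
      simp only [not_or, not_le] at hcon
      exact hUab _ hu ⟨hcon.1, hcon.2.2⟩
    · rcases hQab p hp with h1 | h1
      · exact Or.inl (hu ▸ (hQpos p hp).2.trans h1)
      · exact Or.inr (Or.inr (hu ▸ h1))
    · rcases hQab p hp with h1 | h1
      · exact Or.inl (hu ▸ h1)
      · exact Or.inr (Or.inr (hu ▸ h1.trans (hQpos p hp).2))
    · exact Or.inl hu.le
    · exact Or.inr (Or.inl hu)
    · exact Or.inr (Or.inr hu.ge)
  have hlt : ∀ {j k}, v j < v k → j < k := by
    intro j k hjk
    by_contra hle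
    exact absurd (hv.mono (not_lt.1 hle)) (not_le.2 hjk)
  obtain ⟨ja, hja, hva⟩ := (hvV a).1 (by simp)
  obtain ⟨jx, hjx, hvx⟩ := (hvV x).1 (by simp)
  obtain ⟨jb, hjb, hvb⟩ := (hvV b).1 (by simp)
  have hax' : ja < jx := hlt (by rwa [hva, hvx])
  have hxb' : jx < jb := hlt (by rwa [hvx, hvb])
  have hjx' : jx = ja + 1 := by
    by_contra hne
    have h1 := hv.strict ja (ja + 1) (by omega) (by omega)
    have h2 := hv.strict (ja + 1) jx (by omega) (by omega)
    rcases hvout (ja + 1) (by omega) with h3 | h3 | h3 <;> linarith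
  have hjb' : jb = jx + 1 := by
    by_contra hne
    have h1 := hv.strict jx (jx + 1) (by omega) (by omega)
    have h2 := hv.strict (jx + 1) jb (by omega) (by omega)
    rcases hvout (jx + 1) (by omega) with h3 | h3 | h3 <;> linarith
  subst hjx' hjb'
  let k₀ : Fin m := ⟨ja, by omega⟩
  let k₁ : Fin m := ⟨ja + 1, by omega⟩
  let base : Set Ω := {ω | (K fun u => D u ω) ∧ ∀ p ∈ Q, eventCount Γ p.1 p.2 ω = 1}
  have hK' : ∀ d d' : ℝ → ι, (∀ j ≤ m, j ≠ k₁ → d (v j) = d' (v j)) → (K d ↔ K d') := by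
    intro d d' hd
    refine hK d d' fun u hu => ?_
    obtain ⟨j, hj, rfl⟩ := (hvV u).1 (by simp [hu])
    refine hd j hj ?_
    rintro rfl
    refine hUab _ hu ?_
    simp only [k₁]
    rw [hvx]
    exact ⟨hax, hxb⟩
  have hmemQ : ∀ p ∈ Q, (∃ j ≤ m, j ≠ k₁ ∧ v j = p.1) ∧ (∃ j ≤ m, j ≠ k₁ ∧ v j = p.2) := by
    intro p hp
    have hne : p.1 ≠ x ∧ p.2 ≠ x := by
      have := hQpos p hp
      rcases hQab p hp with h1 | h1
      · exact ⟨by linarith, by linarith⟩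
      · exact ⟨by linarith, by linarith⟩
    constructor
    · obtain ⟨j, hj, hjp⟩ := (hvV p.1).1
        (by simp only [Finset.mem_union, Finset.mem_image]; exact .inl (.inr (.inl ⟨p, hp, rfl⟩)))
      refine ⟨j, hj, ?_, hjp⟩
      rintro rfl
      exact hne.1 (hjp.symm.trans hvx)
    · obtain ⟨j, hj, hjp⟩ := (hvV p.2).1
        (by simp only [Finset.mem_union, Finset.mem_image]; exact .inl (.inr (.inr ⟨p, hp, rfl⟩)))
      refine ⟨j, hj, ?_, hjp⟩
      rintro rfl
      exact hne.2 (hjp.symm.trans hvx)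
  have hcount : ∀ n : Fin m → ℕ, ∀ ω ∈ cellEvent Γ v n, ∀ p ∈ Q,
      (eventCount Γ p.1 p.2 ω = 1 ↔ gridCount v n p.2 = gridCount v n p.1 + 1) := by
    intro n ω hω p hp
    obtain ⟨⟨j, hj, -, hjp⟩, ⟨j', hj', -, hjp'⟩⟩ := hmemQ p hp
    rw [← hjp, ← hjp', ← hv.eventCount_eq_gridCount (h.finite_events ω) hω hj,
      ← hv.eventCount_eq_gridCount (h.finite_events ω) hω hj',
      eventCount_add (h.finite_events ω _ (v j') hv.pos) (hv.mono (Nat.zero_le j))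
        (by rw [hjp, hjp']; exact (hQpos p hp).2)]
    omega
  have hgcQ : ∀ n : Fin m → ℕ,
      (∀ p ∈ Q, gridCount v (n ∘ Equiv.swap k₀ k₁) p.2 =
        gridCount v (n ∘ Equiv.swap k₀ k₁) p.1 + 1) ↔
      ∀ p ∈ Q, gridCount v n p.2 = gridCount v n p.1 + 1 := by
    intro n
    refine forall₂_congr fun p hp => ?_
    obtain ⟨⟨j, hj, hjk, hjp⟩, ⟨j', hj', hjk', hjp'⟩⟩ := hmemQ p hp
    rw [← hjp, ← hjp', hv.gridCount_swap (k₀ := k₀) (k₁ := k₁) rfl hj hjk,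
      hv.gridCount_swap (k₀ := k₀) (k₁ := k₁) rfl hj' hjk']
  let E : ℕ → ℕ → Set Ω := fun i j =>
    base ∩ {ω | eventCount Γ a x ω = i ∧ eventCount Γ x b ω = j}
  have hE : ∀ i j (n : Fin m → ℕ), E i j ∩ cellEvent Γ v n =
      if (∀ p ∈ Q, gridCount v n p.2 = gridCount v n p.1 + 1) ∧ n k₀ = i ∧ n k₁ = j then
        {ω | K fun u => D u ω} ∩ cellEvent Γ v n else ∅ := by
    intro i j n
    have hcell : ∀ ω ∈ cellEvent Γ v n, eventCount Γ a x ω = n k₀ ∧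
        eventCount Γ x b ω = n k₁ := by
      intro ω hω
      rw [← hva, ← hvx, ← hvb]
      exact ⟨hω k₀, hω k₁⟩
    split_ifs with hcond
    · ext ω
      simp only [E, base, mem_inter_iff, mem_ofPred_eq]
      constructor
      · rintro ⟨⟨⟨h1, -⟩, -⟩, h2⟩
        exact ⟨h1, h2⟩
      · rintro ⟨h1, h2⟩
        refine ⟨⟨⟨h1, fun p hp => (hcount n ω h2 p hp).2 (hcond.1 p hp)⟩, ?_⟩, h2⟩
        rw [(hcell ω h2).1, (hcell ω h2).2]
        exact hcond.2
    · rw [eq_empty_iff_forall_notMem]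
      rintro ω ⟨⟨⟨h1, h2⟩, h3⟩, h4⟩
      refine hcond ⟨fun p hp => (hcount n ω h4 p hp).1 (h2 p hp), ?_⟩
      rw [← (hcell ω h4).1, ← (hcell ω h4).2]
      exact h3
  -- Summing the swap identity over all cell counts compares an event in `(a, x]` with one in `(x,
  -- b]`. Adding `P (E 1 0) * ∫ a..x` to both sides then gives the claim.
  have hswap : P (E 1 0) * ENNReal.ofReal (∫ u in x..b, lam u) =
      P (E 0 1) * ENNReal.ofReal (∫ u in a..x, lam u) := by
    rw [h.poisson.measure_eq_tsum hv (E 1 0), h.poisson.measure_eq_tsum hv (E 0 1),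
      ← ENNReal.tsum_mul_right, ← ENNReal.tsum_mul_right,
      ← ((Equiv.swap k₀ k₁).arrowCongr (Equiv.refl ℕ)).tsum_eq
        (fun n => P (E 0 1 ∩ cellEvent Γ v n) * _)]
    refine tsum_congr fun n => ?_
    have harrow : (Equiv.swap k₀ k₁).arrowCongr (Equiv.refl ℕ) n = n ∘ Equiv.swap k₀ k₁ := by
      ext k
      simp [Equiv.arrowCongr]
    rw [harrow, hE, hE]
    simp only [hgcQ, Function.comp_apply, Equiv.swap_apply_left, Equiv.swap_apply_right]
    by_cases hcond : (∀ p ∈ Q, gridCount v n p.2 = gridCount v n p.1 + 1) ∧ n k₀ = 1 ∧ n k₁ = 0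
    · rw [if_pos hcond, if_pos ⟨hcond.1, hcond.2.2, hcond.2.1⟩]
      have := h.measure_cellEvent_swap hv (k₀ := k₀) (k₁ := k₁) rfl hK' hcond.2.1 hcond.2.2
        (hcont _ _ (hv.pos.trans_le (hv.mono (Nat.zero_le _))) (hv.mono (Nat.le_succ _)))
        (hcont _ _ (hv.pos.trans_le (hv.mono (Nat.zero_le _))) (hv.mono (Nat.le_succ _)))
      simp only [k₀, k₁, hva, hvx, hvb] at this
      exact this
    · rw [if_neg hcond, if_neg fun hc => hcond ⟨hc.1, hc.2.2, hc.2.1⟩]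
      simp
  have hadd : ∀ ω, eventCount Γ a b ω = eventCount Γ a x ω + eventCount Γ x b ω := fun ω =>
    eventCount_add (h.finite_events ω a b ha) hax.le hxb.le
  have h10 : {ω | (K fun u => D u ω) ∧ (∀ p ∈ Q, eventCount Γ p.1 p.2 ω = 1) ∧
      eventCount Γ a b ω = 1 ∧ eventCount Γ a x ω = 1} = E 1 0 := by
    ext ω
    have := hadd ω
    simp only [E, base, mem_inter_iff, mem_ofPred_eq]
    constructor
    · rintro ⟨h1, h2, h3, h4⟩
      exact ⟨⟨h1, h2⟩, h4, by omega⟩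
    · rintro ⟨⟨h1, h2⟩, h3, h4⟩
      exact ⟨h1, h2, by omega, h3⟩
  have hsum : P {ω | (K fun u => D u ω) ∧ (∀ p ∈ Q, eventCount Γ p.1 p.2 ω = 1) ∧
      eventCount Γ a b ω = 1} = P (E 1 0) + P (E 0 1) := by
    rw [← measure_inter_add_sdiff _
      (h.poisson.measurable_count a x ha (measurableSet_singleton 1))]
    congr 2
    · rw [← h10]
      ext ω
      simp only [mem_inter_iff, mem_ofPred_eq, mem_preimage, mem_singleton_iff]
      tauto
    · ext ω
      have := hadd ω
      simp only [E, base, mem_inter_iff, mem_sdiff, mem_ofPred_eq, mem_preimage,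
        mem_singleton_iff]
      constructor
      · rintro ⟨⟨h1, h2, h3⟩, h4⟩
        exact ⟨⟨h1, h2⟩, by omega, by omega⟩
      · rintro ⟨⟨h1, h2⟩, h3, h4⟩
        exact ⟨⟨h1, h2, by omega⟩, by omega⟩
  rw [h10, hsum, ← intervalIntegral.integral_add_adjacent_intervals
      (hint a x ha hax.le) (hint x b (ha.trans hax) hxb.le),
    ENNReal.ofReal_add (hcont a x ha hax.le) (hcont x b (ha.trans hax) hxb.le), mul_add, add_mul,
    hswap]

end IsDirectionOfMotion

end FiniteDimensional

/-! ### Occupation times as limits of Riemann sums -/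

section OccupationTimes

variable {ι : Type*}

/-- The time spent in the state `i` up to time `t`. -/
noncomputable def occTime (d : ℝ → ι) (i : ι) (t : ℝ) : ℝ :=
  volume.real {u : ℝ | u ∈ Ioc 0 t ∧ d u = i}

/-- At every positive time the function is constant on a short interval to the right. -/
def RightConst (d : ℝ → ι) : Prop :=
  ∀ u, 0 < u → ∃ ε > 0, ∀ v ∈ Ico u (u + ε), d v = d u

/-- The Riemann sum with `k + 1` intervals for the time spent in the state `i`. -/
noncomputable def riemannOcc (d : ℝ → ι) (i : ι) (t : ℝ) (k : ℕ) : ℝ :=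
  ∑ j ∈ Finset.range (k + 1), if d (t / (k + 1) * (j + 1 : ℕ)) = i then t / (k + 1) else 0

/-- The right end point of the interval of the `k`-th partition of `(0, t]` that contains `u`. -/
noncomputable def rightPoint (t : ℝ) (k : ℕ) (u : ℝ) : ℝ := t / (k + 1) * ⌈u / (t / (k + 1))⌉₊

variable {d : ℝ → ι} {i : ι} {t : ℝ}

theorem rightPoint_mem (ht : 0 < t) (k : ℕ) {u : ℝ} (hu : 0 < u) :
    rightPoint t k u ∈ Ico u (u + t / (k + 1)) := by
  have hh : 0 < t / (k + 1 : ℝ) := by positivity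
  have h1 := Nat.le_ceil (u / (t / (k + 1 : ℝ)))
  have h2 := Nat.ceil_lt_add_one (div_pos hu hh).le
  rw [div_le_iff₀ hh] at h1
  rw [← sub_lt_iff_lt_add, lt_div_iff₀ hh] at h2
  unfold rightPoint
  constructor <;> nlinarith

theorem measurableSet_rightPoint (d : ℝ → ι) (i : ι) (t : ℝ) (k : ℕ) :
    MeasurableSet {u : ℝ | u ∈ Ioc 0 t ∧ d (rightPoint t k u) = i} := by
  have h1 : Measurable fun u : ℝ => ⌈u / (t / (k + 1 : ℝ))⌉₊ :=
    Nat.measurable_ceil.comp (measurable_id.div_const _)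
  exact measurableSet_Ioc.inter
    (h1 (MeasurableSet.of_discrete (s := {n : ℕ | d (t / (k + 1) * n) = i})))

/-- Right end points approach `u` from the right, where `d` is locally constant, so the indicators
are eventually equal at every `u`, not merely almost everywhere. -/
theorem tendsto_indicator_rightPoint (ht : 0 < t) (hd : RightConst d) (u : ℝ) :
    Filter.Tendsto (fun k => {u : ℝ | u ∈ Ioc 0 t ∧ d (rightPoint t k u) = i}.indicator
      (fun _ => (1 : ℝ)) u) Filter.atTop
      (nhds ({u : ℝ | u ∈ Ioc 0 t ∧ d u = i}.indicator (fun _ => (1 : ℝ)) u)) := by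
  refine tendsto_const_nhds.congr' ?_
  by_cases hu : u ∈ Ioc 0 t
  · obtain ⟨ε, hε, hv⟩ := hd u hu.1
    have hlim : Filter.Tendsto (fun k : ℕ => t / ((k : ℝ) + 1)) Filter.atTop (nhds 0) := by
      simpa [div_eq_mul_inv] using tendsto_one_div_add_atTop_nhds_zero_nat.const_mul t
    filter_upwards [hlim.eventually_lt_const hε] with k hk
    have := hv (rightPoint t k u)
      ⟨(rightPoint_mem ht k hu.1).1, (rightPoint_mem ht k hu.1).2.trans (by linarith)⟩
    simp [indicator, this]
  · refine Filter.Eventually.of_forall fun k => ?_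
    simp only [indicator, mem_ofPred_eq, hu, false_and, if_false]

/-- Measurability of `d` is not assumed; it comes from the pointwise limit of step functions. -/
theorem measurableSet_occ (ht : 0 < t) (hd : RightConst d) (i : ι) :
    MeasurableSet {u : ℝ | u ∈ Ioc 0 t ∧ d u = i} := by
  refine (measurable_indicator_const_iff (1 : ℝ)).1 ?_
  refine measurable_of_tendsto_metrizable
    (f := fun k => {u : ℝ | u ∈ Ioc 0 t ∧ d (rightPoint t k u) = i}.indicator fun _ => 1)
    (fun k => measurable_const.indicator (measurableSet_rightPoint d i t k)) ?_
  rw [tendsto_pi_nhds]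
  exact tendsto_indicator_rightPoint ht hd

theorem volumeReal_rightPoint (ht : 0 < t) (d : ℝ → ι) (i : ι) (k : ℕ) :
    volume.real {u : ℝ | u ∈ Ioc 0 t ∧ d (rightPoint t k u) = i} = riemannOcc d i t k := by
  have hh : 0 < t / (k + 1 : ℝ) := by positivity
  have hset : {u : ℝ | u ∈ Ioc 0 t ∧ d (rightPoint t k u) = i} =
      ⋃ j ∈ Finset.range (k + 1), (if d (t / (k + 1) * (j + 1 : ℕ)) = i then
        Ioc (t / (k + 1) * j) (t / (k + 1) * (j + 1 : ℕ)) else ∅) := by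
    ext u
    simp only [mem_ofPred_eq, mem_iUnion, Finset.mem_range, exists_prop, mem_ite_empty_right]
    have hceil : ∀ j : ℕ, u ∈ Ioc (t / (k + 1) * j) (t / (k + 1) * (j + 1 : ℕ)) ↔
        ⌈u / (t / (k + 1 : ℝ))⌉₊ = j + 1 := by
      intro j
      rw [Nat.ceil_eq_iff (Nat.succ_ne_zero j), div_le_iff₀ hh, lt_div_iff₀ hh, mem_Ioc,
        Nat.succ_sub_one, mul_comm (j : ℝ), mul_comm ((j + 1 : ℕ) : ℝ)]
    constructor
    · rintro ⟨⟨hu0, hut⟩, hu⟩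
      have h1 : 0 < ⌈u / (t / (k + 1 : ℝ))⌉₊ := Nat.ceil_pos.2 (div_pos hu0 hh)
      have h2 : ⌈u / (t / (k + 1 : ℝ))⌉₊ ≤ k + 1 := by
        rw [Nat.ceil_le, div_le_iff₀ hh]
        push_cast
        rw [mul_div_cancel₀ _ (by positivity)]
        exact hut
      obtain ⟨j, hj⟩ := Nat.exists_eq_succ_of_ne_zero h1.ne'
      refine ⟨j, by omega, ?_, (hceil j).2 hj⟩
      rw [rightPoint, hj] at hu
      exact hu
    · rintro ⟨j, hj, hji, hu⟩
      have hc := (hceil j).1 hu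
      refine ⟨⟨lt_of_le_of_lt (by positivity) hu.1, hu.2.trans ?_⟩, by rwa [rightPoint, hc]⟩
      have : ((j + 1 : ℕ) : ℝ) ≤ k + 1 := by exact_mod_cast hj
      calc t / (k + 1 : ℝ) * (j + 1 : ℕ) ≤ t / (k + 1 : ℝ) * (k + 1) := by gcongr
        _ = t := by field_simp
  rw [hset, measureReal_biUnion_finset _ _ fun j _ => ?_]
  · refine Finset.sum_congr rfl fun j _ => ?_
    split_ifs
    · rw [Real.volume_real_Ioc_of_le (by gcongr; omega)]
      push_cast
      ring
    · simp
  · have hmono : Monotone fun j : ℕ => t / (k + 1 : ℝ) * j := fun j j' hj => by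
      have : (j : ℝ) ≤ j' := by exact_mod_cast hj
      exact mul_le_mul_of_nonneg_left this hh.le
    intro j _ j' _ hne
    refine (hmono.pairwise_disjoint_on_Ioc_succ hne).mono ?_ ?_
    all_goals
      simp only
      split_ifs
      · exact le_rfl
      · exact bot_le
  · intro j _
    split_ifs
    · exact measurableSet_Ioc
    · exact MeasurableSet.empty
  · split_ifs <;> simp

theorem tendsto_riemannOcc (ht : 0 < t) (hd : RightConst d) (i : ι) :
    Filter.Tendsto (riemannOcc d i t) Filter.atTop (nhds (occTime d i t)) := by
  have h := tendsto_integral_of_dominated_convergence (μ := volume)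
    ((Ioc 0 t).indicator fun _ => (1 : ℝ))
    (F := fun k => {u : ℝ | u ∈ Ioc 0 t ∧ d (rightPoint t k u) = i}.indicator fun _ => (1 : ℝ))
    (f := {u : ℝ | u ∈ Ioc 0 t ∧ d u = i}.indicator fun _ => (1 : ℝ))
    (fun k => (measurable_const.indicator
      (measurableSet_rightPoint d i t k)).aestronglyMeasurable)
    ((integrable_indicator_iff measurableSet_Ioc).2 (integrableOn_const (by simp)))
    (fun k => .of_forall fun u => by
      by_cases hu : u ∈ Ioc 0 t
      · rw [indicator_of_mem hu]
        simp only [indicator]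
        split_ifs <;> simp
      · rw [indicator_of_notMem fun h => hu h.1]
        simp [indicator, hu])
    (.of_forall (tendsto_indicator_rightPoint ht hd))
  simp only [integral_indicator_const _ (measurableSet_rightPoint d i t _),
    integral_indicator_const _ (measurableSet_occ ht hd i), smul_eq_mul, mul_one,
    volumeReal_rightPoint ht] at h
  exact h

theorem sum_occTime [Fintype ι] (ht : 0 < t) (hd : RightConst d) :
    ∑ i, occTime d i t = t := by
  unfold occTime
  rw [← measureReal_iUnion_fintype _ _ fun i =>
    ((measure_mono fun u hu => hu.1).trans_lt measure_Ioc_lt_top).ne]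
  · have : ⋃ i, {u : ℝ | u ∈ Ioc 0 t ∧ d u = i} = Ioc 0 t := by
      ext u
      simp
    rw [this, Real.volume_real_Ioc_of_le ht.le, sub_zero]
  · intro i j hij
    rw [Function.onFun, Set.disjoint_left]
    rintro u ⟨-, h1⟩ ⟨-, h2⟩
    exact hij (h1.symm.trans h2)
  · exact measurableSet_occ ht hd

end OccupationTimes

/-! ### Equality of the laws of occupation times -/

section Laws

theorem tendsto_integral_map {Ω E : Type*} [MeasurableSpace Ω] [TopologicalSpace E]
    [MeasurableSpace E] [BorelSpace E] {μ : Measure Ω} [IsFiniteMeasure μ] {X : ℕ → Ω → E}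
    {Y : Ω → E} (hX : ∀ k, Measurable (X k)) (hY : Measurable Y)
    (hlim : ∀ ω, Filter.Tendsto (fun k => X k ω) Filter.atTop (nhds (Y ω)))
    (f : BoundedContinuousFunction E ℝ) :
    Filter.Tendsto (fun k => ∫ x, f x ∂(μ.map (X k))) Filter.atTop
      (nhds (∫ x, f x ∂(μ.map Y))) := by
  have hf : ∀ ν : Measure E, AEStronglyMeasurable f ν := fun ν =>
    f.continuous.measurable.aestronglyMeasurable
  simp only [integral_map hY.aemeasurable (hf _), integral_map (hX _).aemeasurable (hf _)]
  exact tendsto_integral_of_dominated_convergence (fun _ => ‖f‖)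
    (fun k => (f.continuous.measurable.comp (hX k)).aestronglyMeasurable)
    (integrable_const _) (fun k => .of_forall fun ω => f.norm_coe_le_norm _)
    (.of_forall fun ω => (f.continuous.tendsto _).comp (hlim ω))

/-- Limits of random vectors with the same laws have the same law. -/
theorem map_eq_of_tendsto {Ω Ω' E : Type*} [MeasurableSpace Ω] [MeasurableSpace Ω']
    [TopologicalSpace E] [TopologicalSpace.PseudoMetrizableSpace E] [MeasurableSpace E]
    [BorelSpace E] {μ : Measure Ω} [IsFiniteMeasure μ] {μ' : Measure Ω'} [IsFiniteMeasure μ']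
    {X : ℕ → Ω → E} {X' : ℕ → Ω' → E} {Y : Ω → E} {Y' : Ω' → E} (hX : ∀ k, Measurable (X k))
    (hX' : ∀ k, Measurable (X' k))
    (hlim : ∀ ω, Filter.Tendsto (fun k => X k ω) Filter.atTop (nhds (Y ω)))
    (hlim' : ∀ ω, Filter.Tendsto (fun k => X' k ω) Filter.atTop (nhds (Y' ω)))
    (hlaw : ∀ k, μ.map (X k) = μ'.map (X' k)) : μ.map Y = μ'.map Y' := by
  have hY : Measurable Y := measurable_of_tendsto_metrizable hX (tendsto_pi_nhds.2 hlim)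
  have hY' : Measurable Y' := measurable_of_tendsto_metrizable hX' (tendsto_pi_nhds.2 hlim')
  let _ := TopologicalSpace.pseudoMetrizableSpacePseudoMetric E
  refine ext_of_forall_integral_eq_of_IsFiniteMeasure fun f => ?_
  have h1 := tendsto_integral_map (μ := μ) hX hY hlim f
  have h2 := tendsto_integral_map (μ := μ') hX' hY' hlim' f
  simp only [hlaw] at h1
  exact tendsto_nhds_unique h1 h2

variable {Ω Ω' ι : Type*} {t : ℝ}

/-- The times spent in the states `i` and `j` up to time `t`. -/
noncomputable def occPair (D : ℝ → Ω → ι) (i j : ι) (t : ℝ) (ω : Ω) : ℝ × ℝ :=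
  (occTime (fun u => D u ω) i t, occTime (fun u => D u ω) j t)

/-- The Riemann sums for the times spent in the states `i` and `j`. -/
noncomputable def riemannPair (d : ℝ → ι) (i j : ι) (t : ℝ) (k : ℕ) : ℝ × ℝ :=
  (riemannOcc d i t k, riemannOcc d j t k)

theorem tendsto_riemannPair (ht : 0 < t) {D : ℝ → Ω → ι}
    (hR : ∀ ω, RightConst fun u => D u ω) (i j : ι) (ω : Ω) :
    Filter.Tendsto (riemannPair (fun u => D u ω) i j t) Filter.atTop (nhds (occPair D i j t ω)) :=
  (tendsto_riemannOcc ht (hR ω) i).prodMk_nhds (tendsto_riemannOcc ht (hR ω) j)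

variable [MeasurableSpace Ω] [MeasurableSpace Ω']

theorem measurable_riemannPair (ht : 0 < t) {D : ℝ → Ω → ι}
    (hD : ∀ u, 0 < u → ∀ i, MeasurableSet {ω | D u ω = i}) (i j : ι) (k : ℕ) :
    Measurable fun ω => riemannPair (fun u => D u ω) i j t k := by
  have h : ∀ i, Measurable fun ω => riemannOcc (fun u => D u ω) i t k := fun i =>
    Finset.measurable_sum _ fun l _ =>
      Measurable.ite (hD _ (by positivity) i) measurable_const measurable_const
  exact (h i).prodMk (h j)

theorem measurable_occPair (ht : 0 < t) {D : ℝ → Ω → ι}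
    (hD : ∀ u, 0 < u → ∀ i, MeasurableSet {ω | D u ω = i})
    (hR : ∀ ω, RightConst fun u => D u ω) (i j : ι) : Measurable (occPair D i j t) :=
  measurable_of_tendsto_metrizable (measurable_riemannPair ht hD i j)
    (tendsto_pi_nhds.2 (tendsto_riemannPair ht hR i j))

/-- The finite-dimensional distributions determine the joint law of the occupation times. -/
theorem map_occPair_eq {μ : Measure Ω} [IsFiniteMeasure μ] {μ' : Measure Ω'} [IsFiniteMeasure μ']
    (ht : 0 < t) {D : ℝ → Ω → ι} {D' : ℝ → Ω' → ι}
    (hD : ∀ u, 0 < u → ∀ i, MeasurableSet {ω | D u ω = i})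
    (hR : ∀ ω, RightConst fun u => D u ω)
    (hD' : ∀ u, 0 < u → ∀ i, MeasurableSet {ω | D' u ω = i})
    (hR' : ∀ ω, RightConst fun u => D' u ω)
    (hfdd : ∀ U : Finset ℝ, (∀ u ∈ U, 0 < u) → ∀ K : (ℝ → ι) → Prop,
      (∀ d d' : ℝ → ι, (∀ u ∈ U, d u = d' u) → (K d ↔ K d')) →
      μ {ω | K fun u => D u ω} = μ' {ω | K fun u => D' u ω}) (i j : ι) :
    μ.map (occPair D i j t) = μ'.map (occPair D' i j t) := by
  refine map_eq_of_tendsto (measurable_riemannPair ht hD i j) (measurable_riemannPair ht hD' i j)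
    (tendsto_riemannPair ht hR i j) (tendsto_riemannPair ht hR' i j) fun k => ?_
  ext B hB
  rw [Measure.map_apply (measurable_riemannPair ht hD i j k) hB,
    Measure.map_apply (measurable_riemannPair ht hD' i j k) hB]
  refine hfdd ((Finset.range (k + 1)).image fun l : ℕ => t / (k + 1) * ((l + 1 : ℕ) : ℝ)) ?_
    (fun d => riemannPair d i j t k ∈ B) ?_
  · intro u hu
    obtain ⟨l, -, rfl⟩ := Finset.mem_image.1 hu
    positivity
  · intro d d' hdd
    have h : ∀ i, riemannOcc d i t k = riemannOcc d' i t k := fun i =>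
      Finset.sum_congr rfl fun l hl => by rw [hdd _ (Finset.mem_image_of_mem _ hl)]
    simp only [riemannPair, h]

variable [Fintype ι] {P : Measure Ω} {P' : Measure Ω'} {A : ι → Finset ι} {lam : ℝ → ℝ}
  {Γ : Ω → Set ℝ} {D : ℝ → Ω → ι} {Γ' : Ω' → Set ℝ} {D' : ℝ → Ω' → ι}

theorem IsDirectionOfMotion.rightConst (h : IsDirectionOfMotion P A lam Γ D) (ω : Ω) :
    RightConst fun u => D u ω :=
  fun _ hu => h.exists_forall_direction_eq ω hu

/-- The transition rule and the rate function determine the joint law of the occupation times. -/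
theorem IsDirectionOfMotion.map_occPair_eq [IsFiniteMeasure P] [IsFiniteMeasure P']
    (h : IsDirectionOfMotion P A lam Γ D) (h' : IsDirectionOfMotion P' A lam Γ' D') (ht : 0 < t)
    (i j : ι) : P.map (occPair D i j t) = P'.map (occPair D' i j t) :=
  _root_.map_occPair_eq ht h.measurable_direction h.rightConst h'.measurable_direction
    h'.rightConst (fun _ hU _ hK => h.measure_eq_of_finset h' hU hK) i j

end Laws

/-! ### Skipping a time interval -/

section Collapse

variable {ι : Type*} {a b : ℝ}

theorem rightConst_iff_eventually {d : ℝ → ι} :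
    RightConst d ↔ ∀ u, 0 < u → ∀ᶠ v in nhdsWithin u (Ici u), d v = d u := by
  refine forall₂_congr fun u _ => ?_
  constructor
  · rintro ⟨ε, hε, hv⟩
    exact Filter.eventually_of_mem (Ico_mem_nhdsGE (lt_add_of_pos_right u hε)) hv
  · intro hv
    obtain ⟨w, hw, hsub⟩ := (mem_nhdsGE_iff_exists_Ico_subset).1 hv
    exact ⟨w - u, sub_pos.2 hw, fun v hv' => hsub ⟨hv'.1, by linarith [hv'.2]⟩⟩

/-- The time change that skips the interval `[a, b)`. -/
noncomputable def skipIco (a b u : ℝ) : ℝ := if u ∈ Ico a b then b else u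

theorem skipIco_of_mem {u : ℝ} (hu : u ∈ Ico a b) : skipIco a b u = b := if_pos hu

theorem skipIco_of_notMem {u : ℝ} (hu : u ∉ Ico a b) : skipIco a b u = u := if_neg hu

theorem skipIco_notMem (a b u : ℝ) : skipIco a b u ∉ Ico a b := by
  unfold skipIco
  split_ifs with h
  · simp
  · exact h

theorem skipIco_pos (hb : 0 < b) {u : ℝ} (hu : 0 < u) : 0 < skipIco a b u := by
  unfold skipIco
  split_ifs <;> assumption

/-- The skipped interval is closed on the left and open on the right, so membership in it is itself
right-constant. -/
theorem RightConst.comp_skipIco {d : ℝ → ι} (hd : RightConst d) :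
    RightConst fun u => d (skipIco a b u) := by
  rw [rightConst_iff_eventually] at hd ⊢
  intro u hu
  by_cases hab : u ∈ Ico a b
  · filter_upwards [Ico_mem_nhdsGE hab.2] with v hv
    rw [skipIco_of_mem hab, skipIco_of_mem ⟨hab.1.trans hv.1, hv.2⟩]
  · have hev : ∀ᶠ v in nhdsWithin u (Ici u), v ∉ Ico a b := by
      by_cases hua : u < a
      · filter_upwards [Ico_mem_nhdsGE hua] with v hv hv'
        exact absurd hv'.1 (not_le.2 hv.2)
      · have hbu : b ≤ u := by
          by_contra hbu
          exact hab ⟨not_lt.1 hua, not_le.1 hbu⟩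
        filter_upwards [self_mem_nhdsWithin] with v hv hv'
        exact absurd hv'.2 (not_lt.2 (hbu.trans hv))
    filter_upwards [hev, hd u hu] with v hv hv'
    rw [skipIco_of_notMem hv, skipIco_of_notMem hab, hv']

/-- The change of the occupation times if an interval with one change of state is skipped. -/
theorem occTime_eq_skipIco_add {d : ℝ → ι} {t c : ℝ} {i j : ι} (ha : 0 < a)
    (hac : a < c) (hcb : c ≤ b) (hbt : b ≤ t) (hi : ∀ u ∈ Ico a c, d u = i)
    (hj : ∀ u ∈ Icc c b, d u = j) (κ : ι) :
    occTime d κ t = occTime (fun u => d (skipIco a b u)) κ t +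
      (c - a) * ((if i = κ then 1 else 0) - if j = κ then 1 else 0) := by
  have ht : 0 < t := by linarith
  have hfin : ∀ d : ℝ → ι, volume {u : ℝ | u ∈ Ioc 0 t ∧ d u = κ} ≠ ⊤ := fun d =>
    ((measure_mono fun u hu => hu.1).trans_lt measure_Ioc_lt_top).ne
  have hsplit : ∀ d : ℝ → ι, occTime d κ t =
      volume.real ({u : ℝ | u ∈ Ioc 0 t ∧ d u = κ} ∩ Ico a c) +
        volume.real ({u : ℝ | u ∈ Ioc 0 t ∧ d u = κ} \ Ico a c) := fun d =>
    (measureReal_inter_add_sdiff measurableSet_Ico (hfin d)).symm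
  have hinter : ∀ (d : ℝ → ι) (i : ι), (∀ u ∈ Ico a c, d u = i) →
      volume.real ({u : ℝ | u ∈ Ioc 0 t ∧ d u = κ} ∩ Ico a c) =
        (c - a) * if i = κ then 1 else 0 := by
    intro d i hi
    split_ifs with hκ
    · have : {u : ℝ | u ∈ Ioc 0 t ∧ d u = κ} ∩ Ico a c = Ico a c := by
        refine inter_eq_right.2 fun u hu => ⟨⟨ha.trans_le hu.1, ?_⟩, (hi u hu).trans hκ⟩
        linarith [hu.2]
      rw [this, Real.volume_real_Ico_of_le hac.le, mul_one]
    · have : {u : ℝ | u ∈ Ioc 0 t ∧ d u = κ} ∩ Ico a c = ∅ := by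
        rw [eq_empty_iff_forall_notMem]
        rintro u ⟨⟨-, h1⟩, h2⟩
        exact hκ ((hi u h2).symm.trans h1)
      rw [this, measureReal_empty, mul_zero]
  -- Only `[a, c)` is altered: on `[c, b)` both the original and the skipped function have the value
  -- `j`.
  have hdiff : {u : ℝ | u ∈ Ioc 0 t ∧ d u = κ} \ Ico a c =
      {u : ℝ | u ∈ Ioc 0 t ∧ d (skipIco a b u) = κ} \ Ico a c := by
    ext u
    simp only [mem_sdiff, mem_ofPred_eq]
    refine and_congr_left fun hu => and_congr_right fun _ => ?_
    by_cases hab : u ∈ Ico a b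
    · have hcu : c ≤ u := by
        by_contra hcu
        exact hu ⟨hab.1, not_le.1 hcu⟩
      rw [skipIco_of_mem hab, hj u ⟨hcu, hab.2.le⟩, hj b ⟨hcb, le_rfl⟩]
    · rw [skipIco_of_notMem hab]
  rw [hsplit d, hsplit fun u => d (skipIco a b u), hdiff, hinter d i hi,
    hinter (fun u => d (skipIco a b u)) j fun u hu => by
      rw [skipIco_of_mem ⟨hu.1, hu.2.trans_le hcb⟩, hj b ⟨hcb, le_rfl⟩]]
  ring

end Collapse

/-! ### The time of a single event -/

section EventTime

variable {Ω : Type*} {Γ : Ω → Set ℝ} {a b : ℝ} {ω : Ω}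

/-- The time of the event in `(a, b]`, if there is exactly one. -/
noncomputable def eventTime (Γ : Ω → Set ℝ) (a b : ℝ) (ω : Ω) : ℝ :=
  if eventCount Γ a b ω = 1 then sInf (Γ ω ∩ Ioc a b) else b

theorem inter_Ioc_eq_eventTime (h : eventCount Γ a b ω = 1) :
    Γ ω ∩ Ioc a b = {eventTime Γ a b ω} := by
  obtain ⟨τ, hτ⟩ := ncard_eq_one.1 h
  rw [eventTime, if_pos h, hτ, csInf_singleton]

theorem eventTime_mem (h : eventCount Γ a b ω = 1) : eventTime Γ a b ω ∈ Ioc a b := by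
  have : eventTime Γ a b ω ∈ Γ ω ∩ Ioc a b := by
    rw [inter_Ioc_eq_eventTime h]
    rfl
  exact this.2

theorem eventTime_le_iff (h : eventCount Γ a b ω = 1) {x : ℝ} (hx : x ≤ b) :
    eventTime Γ a b ω ≤ x ↔ eventCount Γ a x ω = 1 := by
  have hset : Γ ω ∩ Ioc a x = {eventTime Γ a b ω} ∩ Iic x := by
    rw [← inter_Ioc_eq_eventTime h, inter_assoc, Ioc_inter_Iic, min_eq_right hx]
  rw [eventCount, hset]
  by_cases hτ : eventTime Γ a b ω ≤ x
  · rw [inter_eq_left.2 (singleton_subset_iff.2 (mem_Iic.2 hτ))]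
    simp [hτ]
  · rw [singleton_inter_eq_empty.2 fun h => hτ (mem_Iic.1 h)]
    simp [hτ]

/-- The default value `b` keeps outcomes without a unique event out of `{τ ≤ x}` for every `x < b`;
there the set is described by two counts, and for `x ≥ b` it is everything. -/
theorem measurable_eventTime [MeasurableSpace Ω] {P : Measure Ω} {lam : ℝ → ℝ}
    (h : IsPoissonEvents P lam Γ) (ha : 0 < a) : Measurable (eventTime Γ a b) := by
  have hm := fun x => h.measurable_count a x ha (measurableSet_singleton 1)
  refine measurable_of_Iic fun x => ?_
  rcases le_or_gt b x with hx | hx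
  · have : eventTime Γ a b ⁻¹' Iic x = univ := by
      refine eq_univ_of_forall fun ω => ?_
      by_cases h1 : eventCount Γ a b ω = 1
      · exact (eventTime_mem h1).2.trans hx
      · simpa [eventTime, h1] using hx
    rw [this]
    exact MeasurableSet.univ
  · have : eventTime Γ a b ⁻¹' Iic x =
        eventCount Γ a b ⁻¹' {1} ∩ eventCount Γ a x ⁻¹' {1} := by
      ext ω
      simp only [mem_preimage, mem_Iic, mem_inter_iff, mem_singleton_iff]
      by_cases h1 : eventCount Γ a b ω = 1
      · simp [h1, eventTime_le_iff h1 hx.le]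
      · simp [eventTime, h1, hx]
    rw [this]
    exact (hm b).inter (hm x)

end EventTime

/-! ### Measures determined by their values on half-lines -/

section SingleInterval

/-- Measures on an interval are determined by their distribution functions there. -/
theorem measure_Iic_eq_clamp {μ : Measure ℝ} {a b : ℝ}
    (hμ : μ (Ioc a b)ᶜ = 0) (x : ℝ) : μ (Iic x) = μ (Iic (max a (min x b))) := by
  have hae : ∀ᵐ y ∂μ, y ∈ Ioc a b := hμ
  refine measure_congr ?_
  filter_upwards [hae] with y hy
  refine propext ?_
  change y ≤ x ↔ y ≤ max a (min x b)
  rw [le_max_iff, le_min_iff]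
  constructor
  · exact fun h => Or.inr ⟨h, hy.2⟩
  · rintro (h | h)
    · exact absurd hy.1 (not_lt.2 h)
    · exact h.1

/-- The measure with density `lam` on `(a, b]`. -/
noncomputable def rateMeasure (lam : ℝ → ℝ) (a b : ℝ) : Measure ℝ :=
  (volume.restrict (Ioc a b)).withDensity fun u => ENNReal.ofReal (lam u)

variable {lam : ℝ → ℝ} {a b : ℝ}

theorem rateMeasure_Iic (hint : IntervalIntegrable lam volume a b)
    (hpos : ∀ t ∈ Ioc a b, 0 ≤ lam t) {x : ℝ} (hx : x ∈ Icc a b) :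
    rateMeasure lam a b (Iic x) = ENNReal.ofReal (∫ u in a..x, lam u) := by
  rw [rateMeasure, withDensity_apply _ measurableSet_Iic,
    Measure.restrict_restrict measurableSet_Iic, Iic_inter_Ioc_of_le hx.2,
    intervalIntegral.integral_of_le hx.1, ofReal_integral_eq_lintegral_ofReal]
  · exact ((intervalIntegrable_iff_integrableOn_Ioc_of_le (hx.1.trans hx.2)).1 hint).mono_set
      (Ioc_subset_Ioc_right hx.2)
  · exact (ae_restrict_iff' measurableSet_Ioc).2
      (.of_forall fun u hu => hpos u ⟨hu.1, hu.2.trans hx.2⟩)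

theorem rateMeasure_compl (lam : ℝ → ℝ) (a b : ℝ) : rateMeasure lam a b (Ioc a b)ᶜ = 0 :=
  (withDensity_absolutelyContinuous _ _) (by
    rw [Measure.restrict_apply measurableSet_Ioc.compl]
    simp)

theorem rateMeasure_absolutelyContinuous (lam : ℝ → ℝ) (a b : ℝ) :
    rateMeasure lam a b ≪ volume :=
  (withDensity_absolutelyContinuous _ _).trans Measure.absolutelyContinuous_restrict

theorem isFiniteMeasure_rateMeasure (hint : IntervalIntegrable lam volume a b) (hab : a ≤ b) :
    IsFiniteMeasure (rateMeasure lam a b) :=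
  isFiniteMeasure_withDensity_ofReal
    ((intervalIntegrable_iff_integrableOn_Ioc_of_le hab).1 hint).2

/-- The half-lines `(-∞, n]` exhaust the real line. -/
noncomputable def spanningSetsIic (μ : Measure ℝ) [IsFiniteMeasure μ] :
    μ.FiniteSpanningSetsIn (range Iic) where
  set n := Iic n
  set_mem n := ⟨n, rfl⟩
  finite _ := measure_lt_top μ _
  spanning := eq_univ_of_forall fun x => mem_iUnion.2 (exists_nat_ge x)

theorem prod_eq_of_Iic {μ ν : Measure ℝ} [IsFiniteMeasure μ] [IsFiniteMeasure ν]
    {θ : Measure (ℝ × ℝ)} (h : ∀ x y, θ (Iic x ×ˢ Iic y) = μ (Iic x) * ν (Iic y)) :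
    μ.prod ν = θ := by
  refine Measure.prod_eq_generateFrom (C := range Iic) (D := range Iic)
    (borel_eq_generateFrom_Iic ℝ ▸ BorelSpace.measurable_eq.symm)
    (borel_eq_generateFrom_Iic ℝ ▸ BorelSpace.measurable_eq.symm) isPiSystem_Iic isPiSystem_Iic
    (spanningSetsIic μ) (spanningSetsIic ν) ?_
  rintro _ ⟨x, rfl⟩ _ ⟨y, rfl⟩
  exact h x y

end SingleInterval

/-! ### Affine images of planar Lebesgue measure -/

section Affine

/-- The affine map with linear part `(x, y) ↦ (p x + q y, r x + s y)`. -/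
noncomputable def affinePair (p q r s : ℝ) (w z : ℝ × ℝ) : ℝ × ℝ :=
  w + (p * z.1 + q * z.2, r * z.1 + s * z.2)

theorem measurable_affinePair (p q r s : ℝ) (w : ℝ × ℝ) : Measurable (affinePair p q r s w) := by
  unfold affinePair
  fun_prop

theorem map_affinePair_volume {p q r s : ℝ} (hdet : p * s - q * r ≠ 0) (w : ℝ × ℝ) :
    (volume : Measure (ℝ × ℝ)).map (affinePair p q r s w) =
      ENNReal.ofReal |(p * s - q * r)⁻¹| • volume := by
  let M : (ℝ × ℝ) →ₗ[ℝ] (ℝ × ℝ) :=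
    Matrix.toLin (Module.Basis.finTwoProd ℝ) (Module.Basis.finTwoProd ℝ) !![p, q; r, s]
  have hM : M.det = p * s - q * r := by
    simp only [M, LinearMap.det_toLin, Matrix.det_fin_two_of]
  have hcomp : affinePair p q r s w = (fun z => w + z) ∘ M := by
    funext z
    simp only [affinePair, M, Function.comp, Matrix.toLin_finTwoProd_apply]
  have hMm : Measurable M := M.continuous_of_finiteDimensional.measurable
  rw [hcomp, ← Measure.map_map (measurable_const_add w) hMm,
    Measure.map_linearMap_addHaar_eq_smul_addHaar _ (by rwa [hM]), hM, Measure.map_smul,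
    map_add_left_eq_self]

end Affine

/-! ### Two different changes among three states -/

section Changes

/-- If all changes exchanged the same unordered pair `z`, the sequence would either stay at its
initial value or remain inside `z`, and could not take three values. -/
theorem exists_two_changes {d : ℕ → Fin 3} {p : Fin 3 → ℕ} (hp : ∀ κ, d (p κ) = κ) {M M' : ℕ}
    (hM : ∀ κ, M ≤ p κ) (hM' : ∀ κ, p κ ≤ M') :
    ∃ m m', M ≤ m ∧ m < m' ∧ m' < M' ∧ d m ≠ d (m + 1) ∧ d m' ≠ d (m' + 1) ∧
      s(d m, d (m + 1)) ≠ s(d m', d (m' + 1)) := by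
  by_contra hcon
  push Not at hcon
  have hsame : ∀ m m', M ≤ m → m < M' → M ≤ m' → m' < M' → d m ≠ d (m + 1) →
      d m' ≠ d (m' + 1) → s(d m, d (m + 1)) = s(d m', d (m' + 1)) := by
    intro m m' h1 h2 h3 h4 h5 h6
    rcases lt_trichotomy m m' with hlt | rfl | hlt
    · exact hcon m m' h1 hlt h4 h5 h6
    · rfl
    · exact (hcon m' m h3 hlt h2 h6 h5).symm
  obtain ⟨z, hz⟩ : ∃ z : Sym2 (Fin 3), ∀ m, M ≤ m → m < M' → d m ≠ d (m + 1) →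
      s(d m, d (m + 1)) = z := by
    by_cases hex : ∃ m, M ≤ m ∧ m < M' ∧ d m ≠ d (m + 1)
    · obtain ⟨m, h1, h2, h3⟩ := hex
      exact ⟨s(d m, d (m + 1)), fun m' h4 h5 h6 => hsame m' m h4 h5 h1 h2 h6 h3⟩
    · exact ⟨s(0, 0), fun m h1 h2 h3 => absurd ⟨m, h1, h2, h3⟩ hex⟩
  have hmem : ∀ m, M ≤ m → m ≤ M' → (d m = d M ∨ d m ∈ z ∧ d M ∈ z) := by
    intro m hm
    induction m, hm using Nat.le_induction with
    | base => simp
    | succ m hm ih =>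
      intro hm'
      by_cases hne : d m = d (m + 1)
      · rw [← hne]
        exact ih (by omega)
      · have := hz m hm (by omega) hne
        rcases ih (by omega) with h | h
        · refine Or.inr ?_
          rw [← h, ← this]
          simp
        · refine Or.inr ⟨?_, h.2⟩
          rw [← this]
          simp
  have hall : ∀ κ, κ = d M ∨ κ ∈ z ∧ d M ∈ z := fun κ => by
    have := hmem (p κ) (hM κ) (hM' κ)
    rwa [hp] at this
  generalize d M = x at hall
  clear hz hmem
  induction z with | _ y y'
  have h0 := hall 0
  have h1 := hall 1
  have h2 := hall 2
  simp only [Sym2.mem_iff, Fin.ext_iff] at h0 h1 h2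
  omega

end Changes

/-! ### Independence of two single-event times from the rest -/

section TwoJumps

variable {Ω ι : Type*} {Γ : Ω → Set ℝ} {D : ℝ → Ω → ι} {a b a' b' t : ℝ} {i j k l : ι}

/-- There is exactly one event in `(a, b]`, where the direction changes from `i` to `j`, and
exactly one event in `(a', b']`, where the direction changes from `k` to `l`. -/
def jumpEvent (Γ : Ω → Set ℝ) (D : ℝ → Ω → ι) (a b a' b' : ℝ) (i j k l : ι) : Set Ω :=
  {ω | (D a ω = i ∧ D b ω = j ∧ D a' ω = k ∧ D b' ω = l) ∧
    eventCount Γ a b ω = 1 ∧ eventCount Γ a' b' ω = 1}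

/-- The direction process with the intervals `[a, b)` and `[a', b')` skipped. -/
noncomputable def skipped (D : ℝ → Ω → ι) (a b a' b' u : ℝ) : Ω → ι :=
  D (skipIco a b (skipIco a' b' u))

variable [MeasurableSpace Ω] [Fintype ι] {P : Measure Ω} {A : ι → Finset ι} {lam : ℝ → ℝ}

namespace IsDirectionOfMotion

theorem measurableSet_jumpEvent (h : IsDirectionOfMotion P A lam Γ D) (ha : 0 < a) (hb : 0 < b)
    (ha' : 0 < a') (hb' : 0 < b') : MeasurableSet (jumpEvent Γ D a b a' b' i j k l) :=
  ((h.measurable_direction a ha i).inter ((h.measurable_direction b hb j).inter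
    ((h.measurable_direction a' ha' k).inter (h.measurable_direction b' hb' l)))).inter
    ((h.poisson.measurable_count a b ha (measurableSet_singleton 1)).inter
      (h.poisson.measurable_count a' b' ha' (measurableSet_singleton 1)))

theorem measurableSet_skipped (h : IsDirectionOfMotion P A lam Γ D) (hb : 0 < b) (hb' : 0 < b')
    (u : ℝ) (hu : 0 < u) (i : ι) : MeasurableSet {ω | skipped D a b a' b' u ω = i} :=
  h.measurable_direction _ (skipIco_pos hb (skipIco_pos hb' hu)) i

theorem rightConst_skipped (h : IsDirectionOfMotion P A lam Γ D) (ω : Ω) :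
    RightConst fun u => skipped D a b a' b' u ω :=
  ((h.rightConst ω).comp_skipIco (a := a) (b := b)).comp_skipIco

variable [IsFiniteMeasure P]

/-- The single-event identity is applied once per interval, with the count conditions on the other
interval carried along in `Q`. The skipped process reads no direction strictly inside either
interval, so it counts as outside information both times. -/
theorem measure_jumpEvent_inter (h : IsDirectionOfMotion P A lam Γ D)
    (hint : ∀ s t, 0 < s → s ≤ t → IntervalIntegrable lam volume s t)
    (hpos : ∀ t, 0 < t → 0 < lam t) (ha : 0 < a) (hab : a < b) (hba : b ≤ a') (hab' : a' < b')
    {x y : ℝ} (hx : x ∈ Icc a b) (hy : y ∈ Icc a' b') {U : Finset ℝ} (hU : ∀ u ∈ U, 0 < u)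
    {K : (ℝ → ι) → Prop} (hK : ∀ d d' : ℝ → ι, (∀ u ∈ U, d u = d' u) → (K d ↔ K d')) :
    P ({ω | K fun u => skipped D a b a' b' u ω} ∩ (jumpEvent Γ D a b a' b' i j k l ∩
        {ω | eventTime Γ a b ω ≤ x ∧ eventTime Γ a' b' ω ≤ y})) *
        (ENNReal.ofReal (∫ u in a..b, lam u) * ENNReal.ofReal (∫ u in a'..b', lam u)) =
      P ({ω | K fun u => skipped D a b a' b' u ω} ∩ jumpEvent Γ D a b a' b' i j k l) *
        (ENNReal.ofReal (∫ u in a..x, lam u) * ENNReal.ofReal (∫ u in a'..y, lam u)) := by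
  let K₂ : (ℝ → ι) → Prop := fun d => K (fun u => d (skipIco a b (skipIco a' b' u))) ∧
    d a = i ∧ d b = j ∧ d a' = k ∧ d b' = l
  let U₂ : Finset ℝ := U.image (fun u => skipIco a b (skipIco a' b' u)) ∪ {a, b, a', b'}
  have hmem : ∀ u ∈ U₂, 0 < u ∧ u ∉ Ioo a b ∧ u ∉ Ioo a' b' := by
    intro u hu
    simp only [U₂, Finset.mem_union, Finset.mem_image, Finset.mem_insert,
      Finset.mem_singleton] at hu
    rcases hu with ⟨w, hw, rfl⟩ | rfl | rfl | rfl | rfl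
    · refine ⟨skipIco_pos (ha.trans hab) (skipIco_pos (by linarith) (hU w hw)),
        fun hu => skipIco_notMem a b _ (Ioo_subset_Ico_self hu), ?_⟩
      by_cases hw' : skipIco a' b' w ∈ Ico a b
      · rw [skipIco_of_mem hw']
        exact fun hb => absurd hb.1 (not_lt.2 hba)
      · rw [skipIco_of_notMem hw']
        exact fun hu => skipIco_notMem a' b' _ (Ioo_subset_Ico_self hu)
    all_goals
      refine ⟨by linarith, fun hu => ?_, fun hu => ?_⟩ <;> linarith [hu.1, hu.2]
  have hK₂ : ∀ d d' : ℝ → ι, (∀ u ∈ U₂, d u = d' u) → (K₂ d ↔ K₂ d') := by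
    intro d d' hd
    have h1 := hK (fun u => d (skipIco a b (skipIco a' b' u)))
      (fun u => d' (skipIco a b (skipIco a' b' u))) fun u hu =>
        hd _ (Finset.mem_union_left _ (Finset.mem_image_of_mem _ hu))
    simp only [K₂, h1, hd a (by simp [U₂]), hd b (by simp [U₂]), hd a' (by simp [U₂]),
      hd b' (by simp [U₂])]
  have ha' : 0 < a' := by linarith
  have h1 := h.measure_single_event hint hpos ha hx.1 hx.2 (fun u hu => (hmem u hu).1)
    (fun u hu => (hmem u hu).2.1) hK₂ {(a', y), (a', b')}
    (by simp [ha', hy.1, hab'.le]) (by simp [hba])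
  have h2 := h.measure_single_event hint hpos ha' hy.1 hy.2 (fun u hu => (hmem u hu).1)
    (fun u hu => (hmem u hu).2.2) hK₂ {(a, b)}
    (by simp [ha, hab.le]) (by simp [hba])
  have e1 : {ω | K fun u => skipped D a b a' b' u ω} ∩ (jumpEvent Γ D a b a' b' i j k l ∩
        {ω | eventTime Γ a b ω ≤ x ∧ eventTime Γ a' b' ω ≤ y}) =
      {ω | (K₂ fun u => D u ω) ∧
        (∀ p ∈ ({(a', y), (a', b')} : Finset (ℝ × ℝ)), eventCount Γ p.1 p.2 ω = 1) ∧
        eventCount Γ a b ω = 1 ∧ eventCount Γ a x ω = 1} := by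
    ext ω
    simp only [jumpEvent, skipped, K₂, mem_inter_iff, mem_ofPred_eq, Finset.mem_insert,
      Finset.mem_singleton, forall_eq_or_imp, forall_eq]
    constructor
    · rintro ⟨h1, ⟨h2, h3, h4⟩, h5, h6⟩
      exact ⟨⟨h1, h2⟩, ⟨(eventTime_le_iff h4 hy.2).1 h6, h4⟩, h3,
        (eventTime_le_iff h3 hx.2).1 h5⟩
    · rintro ⟨⟨h1, h2⟩, ⟨h6, h4⟩, h3, h5⟩
      exact ⟨h1, ⟨h2, h3, h4⟩, (eventTime_le_iff h3 hx.2).2 h5, (eventTime_le_iff h4 hy.2).2 h6⟩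
  have e2 : {ω | (K₂ fun u => D u ω) ∧
        (∀ p ∈ ({(a', y), (a', b')} : Finset (ℝ × ℝ)), eventCount Γ p.1 p.2 ω = 1) ∧
        eventCount Γ a b ω = 1} =
      {ω | (K₂ fun u => D u ω) ∧
        (∀ p ∈ ({(a, b)} : Finset (ℝ × ℝ)), eventCount Γ p.1 p.2 ω = 1) ∧
        eventCount Γ a' b' ω = 1 ∧ eventCount Γ a' y ω = 1} := by
    ext ω
    simp only [mem_ofPred_eq, Finset.mem_insert, Finset.mem_singleton, forall_eq_or_imp, forall_eq]
    tauto
  have e3 : {ω | (K₂ fun u => D u ω) ∧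
        (∀ p ∈ ({(a, b)} : Finset (ℝ × ℝ)), eventCount Γ p.1 p.2 ω = 1) ∧
        eventCount Γ a' b' ω = 1} =
      {ω | K fun u => skipped D a b a' b' u ω} ∩ jumpEvent Γ D a b a' b' i j k l := by
    ext ω
    simp only [jumpEvent, skipped, K₂, mem_inter_iff, mem_ofPred_eq, Finset.mem_singleton,
      forall_eq]
    tauto
  rw [e1, ← mul_assoc, h1, mul_right_comm, e2, h2, e3]
  ring

/-- Given the event with two jumps, the jump times and the occupation times of the process without
the two intervals are independent. -/
theorem map_jumpEvent_eq_prod (h : IsDirectionOfMotion P A lam Γ D)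
    (hint : ∀ s t, 0 < s → s ≤ t → IntervalIntegrable lam volume s t)
    (hpos : ∀ t, 0 < t → 0 < lam t) (ha : 0 < a) (hab : a < b) (hba : b ≤ a') (hab' : a' < b')
    (ht : 0 < t) (κ κ' : ι) :
    ((P.restrict (jumpEvent Γ D a b a' b' i j k l)).map
        (occPair (skipped D a b a' b') κ κ' t)).prod
        ((rateMeasure lam a b).prod (rateMeasure lam a' b')) =
      (ENNReal.ofReal (∫ u in a..b, lam u) * ENNReal.ofReal (∫ u in a'..b', lam u)) •
        (P.restrict (jumpEvent Γ D a b a' b' i j k l)).map (fun ω =>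
          (occPair (skipped D a b a' b') κ κ' t ω, (eventTime Γ a b ω, eventTime Γ a' b' ω))) := by
  have hb : 0 < b := ha.trans hab
  have ha' : 0 < a' := hb.trans_le hba
  have hb' : 0 < b' := ha'.trans hab'
  have := isFiniteMeasure_rateMeasure (hint a b ha hab.le) hab.le
  have := isFiniteMeasure_rateMeasure (hint a' b' ha' hab'.le) hab'.le
  set E := jumpEvent Γ D a b a' b' i j k l with hE
  set T := occPair (skipped D a b a' b') κ κ' t with hT
  have hEm : MeasurableSet E := h.measurableSet_jumpEvent ha hb ha' hb'
  have hTm : Measurable T := measurable_occPair ht (h.measurableSet_skipped hb hb')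
    h.rightConst_skipped κ κ'
  have hτ : Measurable (eventTime Γ a b) := measurable_eventTime h.poisson ha
  have hτ' : Measurable (eventTime Γ a' b') := measurable_eventTime h.poisson ha'
  set c := ENNReal.ofReal (∫ u in a..b, lam u) * ENNReal.ofReal (∫ u in a'..b', lam u) with hc
  have hc_top : c ≠ ⊤ := ENNReal.mul_ne_top ENNReal.ofReal_ne_top ENNReal.ofReal_ne_top
  have hpos₀ : ∀ {a b : ℝ}, 0 < a → ∀ t ∈ Ioc a b, 0 ≤ lam t := fun ha t ht =>
    (hpos t (ha.trans ht.1)).le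
  have hIcc : ∀ {x y}, x ∈ Icc a b → y ∈ Icc a' b' → ∀ C, MeasurableSet C →
      P (T ⁻¹' C ∩ (E ∩ {ω | eventTime Γ a b ω ≤ x ∧ eventTime Γ a' b' ω ≤ y})) * c =
        P (T ⁻¹' C ∩ E) * (rateMeasure lam a b (Iic x) * rateMeasure lam a' b' (Iic y)) := by
    intro x y hx hy C hC
    rw [rateMeasure_Iic (hint a b ha hab.le) (hpos₀ ha) hx,
      rateMeasure_Iic (hint a' b' ha' hab'.le) (hpos₀ ha') hy]
    set c' := ENNReal.ofReal (∫ u in a..x, lam u) * ENNReal.ofReal (∫ u in a'..y, lam u)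
    have hc'_top : c' ≠ ⊤ := ENNReal.mul_ne_top ENNReal.ofReal_ne_top ENNReal.ofReal_ne_top
    have hSm : MeasurableSet
        (E ∩ {ω | eventTime Γ a b ω ≤ x ∧ eventTime Γ a' b' ω ≤ y}) :=
      hEm.inter ((hτ measurableSet_Iic).inter (hτ' measurableSet_Iic))
    have : IsFiniteMeasure (c • P.restrict
        (E ∩ {ω | eventTime Γ a b ω ≤ x ∧ eventTime Γ a' b' ω ≤ y})) :=
      Measure.smul_finite _ hc_top
    have : IsFiniteMeasure (c' • P.restrict E) := Measure.smul_finite _ hc'_top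
    -- For fixed `x` and `y`, the skipped process has the same finite-dimensional laws under these
    -- two finite measures, hence the same law of occupation times.
    have hlaw := _root_.map_occPair_eq
      (μ := c • P.restrict (E ∩ {ω | eventTime Γ a b ω ≤ x ∧ eventTime Γ a' b' ω ≤ y}))
      (μ' := c' • P.restrict E) ht
      (h.measurableSet_skipped (a := a) (a' := a') hb hb') h.rightConst_skipped
      (h.measurableSet_skipped (a := a) (a' := a') hb hb') h.rightConst_skipped (by
        intro U hU K hK
        rw [Measure.smul_apply, Measure.smul_apply, Measure.restrict_apply' hSm,
          Measure.restrict_apply' hEm, smul_eq_mul, smul_eq_mul, mul_comm, mul_comm c']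
        exact h.measure_jumpEvent_inter hint hpos ha hab hba hab' hx hy hU hK) κ κ'
    have := congrArg (fun μ => μ C) hlaw
    rw [← hT, Measure.map_apply hTm hC, Measure.map_apply hTm hC, Measure.smul_apply,
      Measure.smul_apply, Measure.restrict_apply' hSm, Measure.restrict_apply' hEm, smul_eq_mul,
      smul_eq_mul, mul_comm, mul_comm c'] at this
    exact this
  have hall : ∀ x y, ∀ C, MeasurableSet C →
      P (T ⁻¹' C ∩ (E ∩ {ω | eventTime Γ a b ω ≤ x ∧ eventTime Γ a' b' ω ≤ y})) * c =
        P (T ⁻¹' C ∩ E) * (rateMeasure lam a b (Iic x) * rateMeasure lam a' b' (Iic y)) := by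
    intro x y C hC
    -- On the jump event the two times lie in their intervals, so arbitrary thresholds may be
    -- clamped to the end points.
    have hclamp : ∀ {a b x : ℝ}, a ≤ b → max a (min x b) ∈ Icc a b := fun hab =>
      ⟨le_max_left _ _, max_le hab (min_le_right _ _)⟩
    rw [measure_Iic_eq_clamp (rateMeasure_compl lam a b) x,
      measure_Iic_eq_clamp (rateMeasure_compl lam a' b') y,
      ← hIcc (hclamp hab.le) (hclamp hab'.le) C hC]
    congr 2
    ext ω
    simp only [mem_inter_iff, mem_ofPred_eq]
    refine and_congr_right fun _ => and_congr_right fun hω => ?_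
    have h1 := eventTime_mem hω.2.1
    have h2 := eventTime_mem hω.2.2
    simp only [le_max_iff, le_min_iff, h1.2, h2.2, not_le.2 h1.1, not_le.2 h2.1, and_true,
      false_or]
  refine Measure.prod_eq fun C R hC hR => ?_
  have hθ : MeasurableSet (T ⁻¹' C) := hTm hC
  have hρ : (P.restrict E).map T C = P (T ⁻¹' C ∩ E) := by
    rw [Measure.map_apply hTm hC, Measure.restrict_apply' hEm]
  have : IsFiniteMeasure ((P.restrict E).map T C • rateMeasure lam a b) :=
    Measure.smul_finite _ (by rw [hρ]; exact measure_ne_top _ _)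
  -- For fixed `C`, both sides are measures in the two event times, and they agree on products of
  -- half-lines.
  have hprod := prod_eq_of_Iic (μ := (P.restrict E).map T C • rateMeasure lam a b)
    (ν := rateMeasure lam a' b')
    (θ := (c • P.restrict (T ⁻¹' C ∩ E)).map fun ω => (eventTime Γ a b ω, eventTime Γ a' b' ω))
    (by
      intro x y
      rw [Measure.map_apply (hτ.prodMk hτ') (measurableSet_Iic.prod measurableSet_Iic),
        Measure.smul_apply, Measure.restrict_apply' (hθ.inter hEm), Measure.smul_apply,
        smul_eq_mul, smul_eq_mul, hρ, mul_assoc (P _), ← hall x y C hC, mul_comm]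
      congr 2
      ext ω
      simp only [mem_inter_iff, mem_preimage, mem_prod, mem_Iic, mem_ofPred_eq]
      tauto)
  have := congrArg (fun μ => μ R) hprod
  rw [Measure.prod_smul_left, Measure.smul_apply, smul_eq_mul] at this
  rw [this, Measure.map_apply (hτ.prodMk hτ') hR, Measure.smul_apply, Measure.smul_apply,
    Measure.map_apply (hTm.prodMk (hτ.prodMk hτ')) (hC.prod hR),
    Measure.restrict_apply' (hθ.inter hEm), Measure.restrict_apply' hEm]
  congr 2
  ext ω
  simp only [mem_inter_iff, mem_preimage, mem_prod]
  tauto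

end IsDirectionOfMotion

end TwoJumps

/-! ### Absolute continuity of the occupation times -/

section AbsoluteContinuity

namespace IsDirectionOfMotion

variable {Ω ι : Type*} [MeasurableSpace Ω] [Fintype ι] {P : Measure Ω} {A : ι → Finset ι}
  {lam : ℝ → ℝ} {Γ : Ω → Set ℝ} {D : ℝ → Ω → ι} {a b a' b' t : ℝ} {i j k l : ι}

theorem direction_eq_left (h : IsDirectionOfMotion P A lam Γ D) {ω : Ω} (ha : 0 < a)
    (hab : eventCount Γ a b ω = 1) {u : ℝ} (hu : u ∈ Ico a (eventTime Γ a b ω)) :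
    D u ω = D a ω := by
  refine h.const_between ω a u ha hu.1 ?_
  rw [eq_empty_iff_forall_notMem]
  rintro z ⟨h1, h2⟩
  have hz : z ∈ Γ ω ∩ Ioc a b := ⟨h1, h2.1, h2.2.trans (hu.2.le.trans (eventTime_mem hab).2)⟩
  rw [inter_Ioc_eq_eventTime hab, mem_singleton_iff] at hz
  linarith [h2.2, hu.2]

theorem direction_eq_right (h : IsDirectionOfMotion P A lam Γ D) {ω : Ω} (ha : 0 < a)
    (hab : eventCount Γ a b ω = 1) {u : ℝ} (hu : u ∈ Icc (eventTime Γ a b ω) b) :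
    D u ω = D b ω := by
  have hau : a < u := (eventTime_mem hab).1.trans_le hu.1
  refine (h.const_between ω u b (ha.trans hau) hu.2 ?_).symm
  rw [eq_empty_iff_forall_notMem]
  rintro z ⟨h1, h2⟩
  have hz : z ∈ Γ ω ∩ Ioc a b := ⟨h1, hau.trans h2.1, h2.2⟩
  rw [inter_Ioc_eq_eventTime hab, mem_singleton_iff] at hz
  linarith [h2.1, hu.1]

/-- The skipping formula is used twice, the second time for the process that already skips `[a, b)`;
since `b ≤ a'`, that process agrees with the original from `a'` on. -/
theorem occTime_eq_on_jumpEvent (h : IsDirectionOfMotion P A lam Γ D) (ha : 0 < a)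
    (hba : b ≤ a') (hbt : b' ≤ t) {ω : Ω} (hω : ω ∈ jumpEvent Γ D a b a' b' i j k l) (κ : ι) :
    occTime (fun u => D u ω) κ t = occTime (fun u => skipped D a b a' b' u ω) κ t +
      (eventTime Γ a b ω - a) * ((if i = κ then 1 else 0) - if j = κ then 1 else 0) +
      (eventTime Γ a' b' ω - a') * ((if k = κ then 1 else 0) - if l = κ then 1 else 0) := by
  obtain ⟨⟨hi, hj, hk, hl⟩, hN, hN'⟩ := hω
  have hτ := eventTime_mem hN
  have hτ' := eventTime_mem hN'
  have hskip : ∀ u, a' ≤ u → skipIco a b u = u := fun u hu =>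
    skipIco_of_notMem fun hu' => absurd hu'.2 (not_lt.2 (hba.trans hu))
  have ha' : 0 < a' := by linarith [hτ.1, hτ.2]
  rw [occTime_eq_skipIco_add ha hτ.1 hτ.2 (by linarith [hτ'.1, hτ'.2])
      (fun u hu => (h.direction_eq_left ha hN hu).trans hi)
      (fun u hu => (h.direction_eq_right ha hN hu).trans hj),
    occTime_eq_skipIco_add (d := fun u => D (skipIco a b u) ω) ha' hτ'.1 hτ'.2 hbt
      (fun u hu => by
        rw [hskip u hu.1]
        exact (h.direction_eq_left ha' hN' hu).trans hk)
      (fun u hu => by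
        rw [hskip u (hτ'.1.le.trans hu.1)]
        exact (h.direction_eq_right ha' hN' hu).trans hl)]
  simp only [skipped]
  ring

variable [IsFiniteMeasure P]

/-- On the jump event the pair of occupation times is an affine function of the two event times,
shifted by the independent skipped part. The condition `hdet` makes the linear part invertible. -/
theorem measure_jumpEvent_inter_eq_zero (h : IsDirectionOfMotion P A lam Γ D)
    (hint : ∀ s t, 0 < s → s ≤ t → IntervalIntegrable lam volume s t)
    (hpos : ∀ t, 0 < t → 0 < lam t) (ha : 0 < a) (hab : a < b) (hba : b ≤ a') (hab' : a' < b')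
    (hbt : b' ≤ t) (κ κ' : ι)
    (hdet : (((if i = κ then 1 else 0) - if j = κ then 1 else 0) *
        ((if k = κ' then 1 else 0) - if l = κ' then 1 else 0) -
      ((if k = κ then 1 else 0) - if l = κ then 1 else 0) *
        ((if i = κ' then 1 else 0) - if j = κ' then 1 else 0) : ℝ) ≠ 0)
    {N : Set (ℝ × ℝ)} (hN : MeasurableSet N) (hN0 : volume N = 0) :
    P (jumpEvent Γ D a b a' b' i j k l ∩ occPair D κ κ' t ⁻¹' N) = 0 := by
  have hb : 0 < b := ha.trans hab
  have ha' : 0 < a' := hb.trans_le hba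
  have hb' : 0 < b' := ha'.trans hab'
  have ht : 0 < t := hb'.trans_le hbt
  have := isFiniteMeasure_rateMeasure (hint a b ha hab.le) hab.le
  have := isFiniteMeasure_rateMeasure (hint a' b' ha' hab'.le) hab'.le
  set p : ℝ := (if i = κ then 1 else 0) - if j = κ then 1 else 0 with hp
  set q : ℝ := (if k = κ then 1 else 0) - if l = κ then 1 else 0 with hq
  set r : ℝ := (if i = κ' then 1 else 0) - if j = κ' then 1 else 0 with hr
  set s : ℝ := (if k = κ' then 1 else 0) - if l = κ' then 1 else 0 with hs
  let w : ℝ × ℝ := (p * a + q * a', r * a + s * a')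
  let F : (ℝ × ℝ) × (ℝ × ℝ) → ℝ × ℝ := fun z => affinePair p q r s (z.1 - w) z.2
  have hF : Measurable F := by
    simp only [F, affinePair]
    fun_prop
  have hprod := h.map_jumpEvent_eq_prod (i := i) (j := j) (k := k) (l := l) hint hpos ha hab hba
    hab' ht κ κ'
  have hnull := congrArg (fun μ => μ (F ⁻¹' N)) hprod
  have hτ : Measurable fun ω => (eventTime Γ a b ω, eventTime Γ a' b' ω) :=
    (measurable_eventTime h.poisson ha).prodMk (measurable_eventTime h.poisson ha')
  have hT : Measurable (occPair (skipped D a b a' b') κ κ' t) :=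
    measurable_occPair ht (h.measurableSet_skipped hb hb') h.rightConst_skipped κ κ'
  have hzero : (((P.restrict (jumpEvent Γ D a b a' b' i j k l)).map
      (occPair (skipped D a b a' b') κ κ' t)).prod
      ((rateMeasure lam a b).prod (rateMeasure lam a' b'))) (F ⁻¹' N) = 0 := by
    -- Fubini: for each fixed value of the skipped pair, the preimage of `N` under an invertible
    -- affine map is Lebesgue null, hence null for the product of the rate measures.
    rw [Measure.measure_prod_null (hF hN)]
    refine .of_forall fun z => ?_
    refine ((rateMeasure_absolutelyContinuous lam a b).prod
      (rateMeasure_absolutelyContinuous lam a' b')) ?_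
    have hpre : Prod.mk z ⁻¹' (F ⁻¹' N) = affinePair p q r s (z - w) ⁻¹' N := rfl
    rw [hpre, ← Measure.volume_eq_prod, ← Measure.map_apply (measurable_affinePair _ _ _ _ _) hN,
      map_affinePair_volume hdet, Measure.smul_apply, hN0, smul_zero]
  rw [hzero, Measure.smul_apply, smul_eq_mul, Measure.map_apply (hT.prodMk hτ) (hF hN),
    Measure.restrict_apply' (h.measurableSet_jumpEvent ha hb ha' hb')] at hnull
  -- Positivity of `lam` enters here: the normalising constant can be cancelled.
  have hΛ : ∀ {a b : ℝ}, 0 < a → a < b → ENNReal.ofReal (∫ u in a..b, lam u) ≠ 0 :=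
    fun ha hab => (ENNReal.ofReal_pos.2 (intervalIntegral.intervalIntegral_pos_of_pos_on
      (hint _ _ ha hab.le) (fun u hu => hpos u (ha.trans hu.1)) hab)).ne'
  rcases mul_eq_zero.1 hnull.symm with h0 | h0
  · exact absurd h0 (mul_ne_zero (hΛ ha hab) (hΛ ha' hab'))
  · refine measure_mono_null ?_ h0
    rintro ω ⟨hE, hω⟩
    refine ⟨?_, hE⟩
    have heq : F (occPair (skipped D a b a' b') κ κ' t ω,
        (eventTime Γ a b ω, eventTime Γ a' b' ω)) = occPair D κ κ' t ω := by
      have h1 := h.occTime_eq_on_jumpEvent ha hba hbt hE κ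
      have h2 := h.occTime_eq_on_jumpEvent ha hba hbt hE κ'
      rw [← hp, ← hq] at h1
      rw [← hr, ← hs] at h2
      simp only [F, affinePair, occPair, w, h1, h2]
      ext <;> simp <;> ring
    simpa only [mem_preimage, heq] using hω

end IsDirectionOfMotion

/-! ### Covering the open simplex by jump events -/

section ThreeDirections

variable {Ω : Type*} [MeasurableSpace Ω] {P : Measure Ω} {A : Fin 3 → Finset (Fin 3)}
  {lam : ℝ → ℝ} {Γ : Ω → Set ℝ} {D : ℝ → Ω → Fin 3} {t : ℝ}

/-- Grids of mesh `1 / (K + 1)` give only countably many candidate cells. Once the mesh is fine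
enough, the path sampled on the grid visits all three states, and each change of state occurs in a
cell with just one event. -/
theorem IsDirectionOfMotion.exists_mem_jumpEvent (h : IsDirectionOfMotion P A lam Γ D) {ω : Ω}
    (hocc : ∀ κ, 0 < occTime (fun u => D u ω) κ t) :
    ∃ K m m' : ℕ, ∃ i j k l : Fin 3, 0 < m ∧ m < m' ∧ ((m' + 1 : ℕ) : ℝ) / (K + 1) ≤ t ∧
      i ≠ j ∧ k ≠ l ∧ s(i, j) ≠ s(k, l) ∧
      ω ∈ jumpEvent Γ D ((m : ℝ) / (K + 1)) (((m + 1 : ℕ) : ℝ) / (K + 1)) ((m' : ℝ) / (K + 1))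
        (((m' + 1 : ℕ) : ℝ) / (K + 1)) i j k l := by
  have hex : ∀ κ, ∃ u, 0 < u ∧ u < t ∧ D u ω = κ := by
    intro κ
    by_contra hcon
    push Not at hcon
    refine (hocc κ).ne' ?_
    have hsub : {u : ℝ | u ∈ Ioc 0 t ∧ D u ω = κ} ⊆ {t} := by
      rintro u ⟨hu, hκ⟩
      by_contra hne
      exact hcon u hu.1 (lt_of_le_of_ne hu.2 hne) hκ
    rw [occTime, measureReal_def, measure_mono_null hsub (by simp), ENNReal.toReal_zero]
  choose u hu0 hut huκ using hex
  have hε : ∀ κ, ∃ ε > 0, u κ + ε ≤ t ∧ ∀ v ∈ Ico (u κ) (u κ + ε), D v ω = κ := by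
    intro κ
    obtain ⟨ε, hε, hv⟩ := h.exists_forall_direction_eq ω (hu0 κ)
    refine ⟨min ε (t - u κ), lt_min hε (sub_pos.2 (hut κ)), ?_, fun v hv' => ?_⟩
    · linarith [min_le_right ε (t - u κ)]
    · rw [hv v ⟨hv'.1, hv'.2.trans_le (by linarith [min_le_left ε (t - u κ)])⟩, huκ]
  choose ε hε hεt hεD using hε
  obtain ⟨s, hs0, hsu⟩ : ∃ s > 0, ∀ κ, s ≤ u κ :=
    ⟨min (u 0) (min (u 1) (u 2)), by simp [hu0], fun κ => by fin_cases κ <;> simp⟩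
  have hfin := h.finite_events ω s t hs0
  -- The smallest gap between events in `(s, t]`, or `1` if there are fewer than two; a cell shorter
  -- than this holds at most one of them.
  obtain ⟨δ, hδ, hsep⟩ : ∃ δ > 0, ∀ x ∈ Γ ω ∩ Ioc s t, ∀ y ∈ Γ ω ∩ Ioc s t, x < y →
      δ ≤ y - x := by
    by_cases hne : ((hfin.toFinset ×ˢ hfin.toFinset).filter fun p : ℝ × ℝ => p.1 < p.2).Nonempty
    · obtain ⟨p, hp, hmin⟩ := Finset.exists_min_image _ (fun p : ℝ × ℝ => p.2 - p.1) hne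
      refine ⟨p.2 - p.1, sub_pos.2 (Finset.mem_filter.1 hp).2, fun x hx y hy hxy => ?_⟩
      exact hmin (x, y) (Finset.mem_filter.2
        ⟨Finset.mem_product.2 ⟨hfin.mem_toFinset.2 hx, hfin.mem_toFinset.2 hy⟩, hxy⟩)
    · refine ⟨1, one_pos, fun x hx y hy hxy => absurd ?_ hne⟩
      exact ⟨(x, y), Finset.mem_filter.2
        ⟨Finset.mem_product.2 ⟨hfin.mem_toFinset.2 hx, hfin.mem_toFinset.2 hy⟩, hxy⟩⟩
  obtain ⟨K, hK⟩ : ∃ K : ℕ, 1 / ((K : ℝ) + 1) < min δ (min (ε 0) (min (ε 1) (ε 2))) :=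
    exists_nat_one_div_lt (by simp [hδ, hε])
  simp only [lt_min_iff] at hK
  have hKε : ∀ κ, 1 / ((K : ℝ) + 1) < ε κ := by
    intro κ
    fin_cases κ
    exacts [hK.2.1, hK.2.2.1, hK.2.2.2]
  have hK0 : (0 : ℝ) < K + 1 := by positivity
  -- The first grid point not before `u κ`; a mesh below `ε κ` keeps it in the interval where the
  -- direction is still `κ`.
  let p : Fin 3 → ℕ := fun κ => ⌈u κ * (K + 1)⌉₊
  have hp1 : ∀ κ, u κ ≤ (p κ : ℝ) / (K + 1) := fun κ => by
    rw [le_div_iff₀ hK0]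
    exact Nat.le_ceil _
  have hp2 : ∀ κ, (p κ : ℝ) / (K + 1) < u κ + ε κ := fun κ => by
    have h1 := Nat.ceil_lt_add_one (mul_pos (hu0 κ) hK0).le
    have h2 := hKε κ
    rw [div_lt_iff₀ hK0] at h2 ⊢
    calc (p κ : ℝ) < u κ * (K + 1) + 1 := h1
      _ < _ := by linarith
  have hp : ∀ κ, D ((p κ : ℝ) / (K + 1)) ω = κ := fun κ => hεD κ _ ⟨hp1 κ, hp2 κ⟩
  obtain ⟨M, ⟨κ₁, hκ₁⟩, hM⟩ : ∃ M, (∃ κ, p κ = M) ∧ ∀ κ, M ≤ p κ := by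
    obtain ⟨κ, -, hκ⟩ := Finset.exists_min_image Finset.univ p Finset.univ_nonempty
    exact ⟨p κ, ⟨κ, rfl⟩, fun κ' => hκ κ' (Finset.mem_univ κ')⟩
  obtain ⟨M', ⟨κ₂, hκ₂⟩, hM'⟩ : ∃ M, (∃ κ, p κ = M) ∧ ∀ κ, p κ ≤ M := by
    obtain ⟨κ, -, hκ⟩ := Finset.exists_max_image Finset.univ p Finset.univ_nonempty
    exact ⟨p κ, ⟨κ, rfl⟩, fun κ' => hκ κ' (Finset.mem_univ κ')⟩
  obtain ⟨m, m', hMm, hmm, hmM, hd, hd', hne⟩ :=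
    exists_two_changes (d := fun n : ℕ => D ((n : ℝ) / (K + 1)) ω) hp hM hM'
  have hMs : s ≤ (M : ℝ) / (K + 1) := hκ₁ ▸ (hsu κ₁).trans (hp1 κ₁)
  have hMt : (M' : ℝ) / (K + 1) ≤ t := hκ₂ ▸ (hp2 κ₂).le.trans (hεt κ₂)
  have hone : ∀ n, M ≤ n → n < M' → D ((n : ℝ) / (K + 1)) ω ≠ D (((n + 1 : ℕ) : ℝ) / (K + 1)) ω →
      eventCount Γ ((n : ℝ) / (K + 1)) (((n + 1 : ℕ) : ℝ) / (K + 1)) ω = 1 := by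
    intro n hn hn' hne
    have hns : s ≤ (n : ℝ) / (K + 1) := hMs.trans (by gcongr)
    have hnt : ((n + 1 : ℕ) : ℝ) / (K + 1) ≤ t := le_trans (by gcongr; exact hn') hMt
    have hlen : ((n + 1 : ℕ) : ℝ) / (K + 1) - (n : ℝ) / (K + 1) = 1 / (K + 1) := by
      push_cast
      ring
    have hle : (n : ℝ) / (K + 1) ≤ ((n + 1 : ℕ) : ℝ) / (K + 1) := by
      gcongr
      omega
    have hn0 : 0 < (n : ℝ) / (K + 1) := hs0.trans_le hns
    have h0 : (Γ ω ∩ Ioc ((n : ℝ) / (K + 1)) (((n + 1 : ℕ) : ℝ) / (K + 1))).Nonempty := by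
      rw [nonempty_iff_ne_empty]
      exact fun hemp => hne (h.const_between ω _ _ hn0 hle hemp).symm
    obtain ⟨x, hx⟩ := h0
    refine ncard_eq_one.2 ⟨x, Subset.antisymm ?_ (singleton_subset_iff.2 hx)⟩
    intro y hy
    have hmem : ∀ z ∈ Γ ω ∩ Ioc ((n : ℝ) / (K + 1)) (((n + 1 : ℕ) : ℝ) / (K + 1)),
        z ∈ Γ ω ∩ Ioc s t := fun z hz => ⟨hz.1, hns.trans_lt hz.2.1, hz.2.2.trans hnt⟩
    rcases lt_trichotomy y x with hyx | hyx | hyx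
    · have := hsep y (hmem y hy) x (hmem x hx) hyx
      linarith [hy.2.1, hx.2.2]
    · exact hyx
    · have := hsep x (hmem x hx) y (hmem y hy) hyx
      linarith [hx.2.1, hy.2.2]
  refine ⟨K, m, m', _, _, _, _, ?_, hmm, ?_, hd, hd', hne, ⟨rfl, rfl, rfl, rfl⟩,
    hone m hMm (by omega) hd, hone m' (by omega) hmM hd'⟩
  · have : 0 < M := by
      rw [← hκ₁]
      exact Nat.ceil_pos.2 (mul_pos (hu0 κ₁) hK0)
    omega
  · exact le_trans (by gcongr; exact hmM) hMt

/-- The vectors `e_i - e_j` and `e_k - e_l` are two non-parallel edges of a triangle, and dropping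
the last coordinate is injective on vectors with sum zero. -/
theorem det_ne_zero_of_two_changes : ∀ {i j k l : Fin 3}, i ≠ j → k ≠ l → s(i, j) ≠ s(k, l) →
    (((if i = 0 then 1 else 0) - if j = 0 then 1 else 0) *
        ((if k = 1 then 1 else 0) - if l = 1 then 1 else 0) -
      ((if k = 0 then 1 else 0) - if l = 0 then 1 else 0) *
        ((if i = 1 then 1 else 0) - if j = 1 then 1 else 0) : ℝ) ≠ 0 := by
  intro i j k l h1 h2 h3
  fin_cases i <;> fin_cases j <;> fin_cases k <;> fin_cases l <;> simp at h1 h2 h3 ⊢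

theorem mem_openSimplex_iff (h : IsDirectionOfMotion P A lam Γ D) (ht : 0 < t) (ω : Ω) :
    occPair D 0 1 t ω ∈ openSimplex t ↔ ∀ κ, 0 < occTime (fun u => D u ω) κ t := by
  have hsum := sum_occTime ht (h.rightConst ω)
  rw [Fin.sum_univ_three] at hsum
  simp only [openSimplex, occPair, mem_ofPred_eq, Fin.forall_fin_succ, Fin.isValue,
    Fin.succ_zero_eq_one, Fin.succ_one_eq_two, IsEmpty.forall_iff, and_true]
  constructor <;> rintro ⟨h1, h2, h3⟩ <;> exact ⟨h1, h2, by linarith⟩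

/-- The joint law of the occupation times is absolutely continuous in the open simplex. -/
theorem IsDirectionOfMotion.measure_occPair_eq_zero [IsFiniteMeasure P]
    (h : IsDirectionOfMotion P A lam Γ D)
    (hint : ∀ s t, 0 < s → s ≤ t → IntervalIntegrable lam volume s t)
    (hpos : ∀ t, 0 < t → 0 < lam t) (ht : 0 < t) {N : Set (ℝ × ℝ)} (hN : MeasurableSet N)
    (hNt : N ⊆ openSimplex t) (hN0 : volume N = 0) : P (occPair D 0 1 t ⁻¹' N) = 0 := by
  have hsub : occPair D 0 1 t ⁻¹' N ⊆ ⋃ (K : ℕ) (m : ℕ) (m' : ℕ) (i : Fin 3) (j : Fin 3)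
      (k : Fin 3) (l : Fin 3) (_ : 0 < m ∧ m < m' ∧ ((m' + 1 : ℕ) : ℝ) / (K + 1) ≤ t ∧
        i ≠ j ∧ k ≠ l ∧ s(i, j) ≠ s(k, l)),
      jumpEvent Γ D ((m : ℝ) / (K + 1)) (((m + 1 : ℕ) : ℝ) / (K + 1)) ((m' : ℝ) / (K + 1))
        (((m' + 1 : ℕ) : ℝ) / (K + 1)) i j k l ∩ occPair D 0 1 t ⁻¹' N := by
    intro ω hω
    obtain ⟨K, m, m', i, j, k, l, h1, h2, h3, h4, h5, h6, h7⟩ :=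
      h.exists_mem_jumpEvent ((mem_openSimplex_iff h ht ω).1 (hNt hω))
    simp only [mem_iUnion]
    exact ⟨K, m, m', i, j, k, l, ⟨h1, h2, h3, h4, h5, h6⟩, h7, hω⟩
  refine measure_mono_null hsub ?_
  simp only [measure_iUnion_null_iff]
  rintro K m m' i j k l ⟨h1, h2, h3, h4, h5, h6⟩
  have hm : (0 : ℝ) < m := by exact_mod_cast h1
  refine h.measure_jumpEvent_inter_eq_zero hint hpos (by positivity) ?_ ?_ ?_ h3 0 1
    (by convert det_ne_zero_of_two_changes h4 h5 h6) hN hN0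
  · gcongr
    omega
  · gcongr
    omega
  · gcongr
    omega

end ThreeDirections

end AbsoluteContinuity

/-! ### From six directions to three axes -/

section Axes

/-- The coordinate axis of an orthogonal direction. -/
def axisOf : Fin 6 → Fin 3 := ![0, 1, 2, 0, 1, 2]

/-- The orientation of an orthogonal direction on its axis. -/
def orientation : Fin 6 → ℝ := ![1, 1, 1, -1, -1, -1]

theorem orientation_ne_zero (i : Fin 6) : orientation i ≠ 0 := by
  fin_cases i <;> simp [orientation]

theorem orthDir_eq (i : Fin 6) :
    orthDir i = orientation i • EuclideanSpace.single (axisOf i) (1 : ℝ) := by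
  ext κ
  fin_cases i <;> fin_cases κ <;> simp [orthDir, orientation, axisOf]

theorem inner_orthDir_eq_zero_iff (i j : Fin 6) :
    inner ℝ (orthDir i) (orthDir j) = 0 ↔ axisOf j ≠ axisOf i := by
  rw [orthDir_eq, orthDir_eq, inner_smul_left, inner_smul_right, EuclideanSpace.inner_single_left]
  simp [orientation_ne_zero, eq_comm]

theorem exists_smul_orthDir_eq_iff {c : ℝ} (hc : c ≠ 0) (i : Fin 6) (κ : Fin 3) :
    (∃ a : ℝ, c • orthDir i = a • EuclideanSpace.single κ (1 : ℝ)) ↔ axisOf i = κ := by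
  rw [orthDir_eq]
  constructor
  · rintro ⟨a, ha⟩
    by_contra hne
    have := congrArg (fun v : EuclideanSpace ℝ (Fin 3) => v (axisOf i)) ha
    simp [hne, hc, orientation_ne_zero] at this
  · rintro rfl
    exact ⟨c * orientation i, by rw [smul_smul]⟩

theorem axisTime_eq_occTime {Ω : Type*} {c : ℝ} (hc : c ≠ 0) (D : ℝ → Ω → Fin 6) (κ : Fin 3)
    (t : ℝ) (ω : Ω) : axisTime c D κ t ω = occTime (fun u => axisOf (D u ω)) κ t := by
  simp only [axisTime, occTime, exists_smul_orthDir_eq_iff hc]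

theorem sum_axisOf_init (b : Fin 3) :
    ∑ i, (if axisOf i = b then 1 / (Fintype.card (Fin 6) : ℝ) else 0)
      = 1 / (Fintype.card (Fin 3) : ℝ) := by
  fin_cases b <;> simp [Fin.sum_univ_succ, axisOf] <;> norm_num

/-- Four directions are orthogonal to the current one, two on each of the other axes, so each of
those axes receives `2/4 = 1/2`. -/
theorem sum_axisOf_orthogonal (i : Fin 6) (b : Fin 3) :
    ∑ j, (if axisOf j = b then uniformChoice (fun i => Finset.univ.filter
      (fun j => inner ℝ (orthDir i) (orthDir j) = 0)) i j else 0)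
      = uniformChoice (fun i : Fin 3 => Finset.univ.erase i) (axisOf i) b := by
  have hA : (Finset.univ.filter fun j => inner ℝ (orthDir i) (orthDir j) = 0) =
      Finset.univ.filter fun j => axisOf j ≠ axisOf i :=
    Finset.filter_congr fun j _ => inner_orthDir_eq_zero_iff i j
  have hcard : (Finset.univ.filter fun j => axisOf j ≠ axisOf i).card = 4 := by
    fin_cases i <;> decide
  simp only [uniformChoice, hA, hcard, Finset.mem_filter, Finset.mem_univ, true_and,
    Finset.mem_erase, and_true, Finset.card_erase_of_mem, Finset.card_univ, Fintype.card_fin]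
  fin_cases i <;> fin_cases b <;> simp [Fin.sum_univ_succ, axisOf] <;> norm_num

theorem sum_axisOf_uniform (i : Fin 6) (b : Fin 3) :
    ∑ j, (if axisOf j = b then uniformChoice (fun _ => Finset.univ) i j else 0)
      = uniformChoice (fun _ : Fin 3 => Finset.univ) (axisOf i) b := by
  simpa [uniformChoice] using sum_axisOf_init b

end Axes

/-! ### Planar position, change of variables and density -/

section Planar

variable {Ω : Type*} {c t : ℝ}

/-- The position of the planar motion as a function of the times spent in the first two
directions. -/
noncomputable def positionMap (c t : ℝ) : ℝ × ℝ → ℝ × ℝ :=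
  affinePair (3 * c / 2) 0 (Real.sqrt 3 * c / 2) (Real.sqrt 3 * c)
    (-(c * t / 2), -(Real.sqrt 3 * c * t / 2))

theorem positionMap_apply (c t : ℝ) (z : ℝ × ℝ) : positionMap c t z =
    (c / 2 * (3 * z.1 - t), Real.sqrt 3 * c / 2 * (z.1 + 2 * z.2 - t)) := by
  ext
  · simp [positionMap, affinePair]
    ring
  · simp [positionMap, affinePair]
    ring

theorem measurable_positionMap (c t : ℝ) : Measurable (positionMap c t) :=
  measurable_affinePair _ _ _ _ _

theorem map_positionMap_volume (hc : 0 < c) (t : ℝ) :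
    (volume : Measure (ℝ × ℝ)).map (positionMap c t) =
      (ENNReal.ofReal (3 * Real.sqrt 3 * c ^ 2 / 2))⁻¹ • volume := by
  have hdet : 3 * c / 2 * (Real.sqrt 3 * c) - 0 * (Real.sqrt 3 * c / 2) =
      3 * Real.sqrt 3 * c ^ 2 / 2 := by ring
  have hpos : 0 < 3 * Real.sqrt 3 * c ^ 2 / 2 := by positivity
  rw [positionMap, map_affinePair_volume (by rw [hdet]; exact hpos.ne'), hdet,
    abs_of_pos (inv_pos.2 hpos), ENNReal.ofReal_inv_of_pos hpos]

/-- The times spent in the first two directions as a function of the position. -/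
noncomputable def positionInv (c t : ℝ) (z : ℝ × ℝ) : ℝ × ℝ :=
  ((2 * z.1 / c + t) / 3, (2 * z.2 / (Real.sqrt 3 * c) + t - (2 * z.1 / c + t) / 3) / 2)

theorem positionInv_positionMap (hc : c ≠ 0) (z : ℝ × ℝ) :
    positionInv c t (positionMap c t z) = z := by
  have h3 : Real.sqrt 3 ≠ 0 := by positivity
  rw [positionMap_apply, positionInv]
  ext
  · field_simp
    ring
  · field_simp
    ring

theorem positionMap_positionInv (hc : c ≠ 0) (z : ℝ × ℝ) :
    positionMap c t (positionInv c t z) = z := by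
  have h3 : Real.sqrt 3 ≠ 0 := by positivity
  rw [positionMap_apply, positionInv]
  ext
  · field_simp
    ring
  · field_simp
    ring

theorem measurable_positionInv (c t : ℝ) : Measurable (positionInv c t) := by
  unfold positionInv
  fun_prop

/-- Occupation times divided by `t` are barycentric coordinates: each edge of the triangle
corresponds to the vanishing of one of them. The bound `z.1 < c * t` in `openTriangle` follows from
the other three. -/
theorem positionMap_mem_openTriangle_iff (hc : 0 < c) (z : ℝ × ℝ) :
    positionMap c t z ∈ openTriangle c t ↔ z ∈ openSimplex t := by
  have h3 : 0 < Real.sqrt 3 := by positivity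
  have hsq : Real.sqrt 3 * Real.sqrt 3 = 3 := Real.mul_self_sqrt (by norm_num)
  have e1 : -(c * t / 2) < c / 2 * (3 * z.1 - t) ↔ 0 < z.1 := by
    rw [← sub_pos, show c / 2 * (3 * z.1 - t) - -(c * t / 2) = 3 * c / 2 * z.1 by ring]
    exact mul_pos_iff_of_pos_left (by positivity)
  have e2 : (c / 2 * (3 * z.1 - t) - c * t) / Real.sqrt 3 <
      Real.sqrt 3 * c / 2 * (z.1 + 2 * z.2 - t) ↔ 0 < z.2 := by
    rw [div_lt_iff₀ h3, ← sub_pos, show Real.sqrt 3 * c / 2 * (z.1 + 2 * z.2 - t) * Real.sqrt 3 -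
      (c / 2 * (3 * z.1 - t) - c * t) = (Real.sqrt 3 * Real.sqrt 3) * (c / 2) *
        (z.1 + 2 * z.2 - t) - (c / 2 * (3 * z.1 - t) - c * t) by ring, hsq,
      show 3 * (c / 2) * (z.1 + 2 * z.2 - t) - (c / 2 * (3 * z.1 - t) - c * t) =
        3 * c * z.2 by ring]
    exact mul_pos_iff_of_pos_left (by positivity)
  have e3 : Real.sqrt 3 * c / 2 * (z.1 + 2 * z.2 - t) <
      (c * t - c / 2 * (3 * z.1 - t)) / Real.sqrt 3 ↔ z.1 + z.2 < t := by
    rw [lt_div_iff₀ h3, ← sub_pos, ← sub_pos (b := z.1 + z.2),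
      show (c * t - c / 2 * (3 * z.1 - t)) -
        Real.sqrt 3 * c / 2 * (z.1 + 2 * z.2 - t) * Real.sqrt 3 =
        (c * t - c / 2 * (3 * z.1 - t)) - (Real.sqrt 3 * Real.sqrt 3) * (c / 2) *
        (z.1 + 2 * z.2 - t) by ring, hsq,
      show (c * t - c / 2 * (3 * z.1 - t)) - 3 * (c / 2) * (z.1 + 2 * z.2 - t) =
        3 * c * (t - (z.1 + z.2)) by ring]
    exact mul_pos_iff_of_pos_left (by positivity)
  rw [positionMap_apply, openTriangle, openSimplex]
  simp only [mem_ofPred_eq]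
  rw [e1, e2, e3]
  constructor
  · rintro ⟨h1, -, h2, h4⟩
    exact ⟨h1, h2, h4⟩
  · rintro ⟨h1, h2, h4⟩
    refine ⟨h1, ?_, h2, h4⟩
    rw [← sub_pos, show c * t - c / 2 * (3 * z.1 - t) = 3 * c / 2 * (t - z.1) by ring]
    exact mul_pos (by positivity) (by linarith)

/-- The velocity is a combination of indicators of the occupation sets, so its integral is the sum
of occupation times multiplied by velocities; the third time is eliminated because the times sum to
`t`. -/
theorem planarPosition_eq (ht : 0 < t) {D : ℝ → Ω → Fin 3} {ω : Ω}
    (hR : RightConst fun u => D u ω) :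
    planarPosition c D t ω = positionMap c t (occPair D 0 1 t ω) := by
  let S : Fin 3 → Set ℝ := fun i => {u | u ∈ Ioc 0 t ∧ D u ω = i}
  have hS : ∀ i, MeasurableSet (S i) := measurableSet_occ ht hR
  have hfin : ∀ i, volume (S i) ≠ ⊤ := fun i =>
    ((measure_mono fun u hu => hu.1).trans_lt measure_Ioc_lt_top).ne
  have hpos : planarPosition c D t ω =
      ∑ i, occTime (fun u => D u ω) i t • planarVel c i := by
    rw [planarPosition, intervalIntegral.integral_of_le ht.le,
      ← integral_indicator measurableSet_Ioc]
    have heq : (Ioc 0 t).indicator (fun u => planarVel c (D u ω)) =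
        fun u => ∑ i, (S i).indicator (fun _ => planarVel c i) u := by
      funext u
      by_cases hu : u ∈ Ioc 0 t
      · rw [indicator_of_mem hu, Finset.sum_eq_single (D u ω)]
        · rw [indicator_of_mem (show u ∈ S (D u ω) from ⟨hu, rfl⟩)]
        · exact fun i _ hi => indicator_of_notMem (fun h => hi h.2.symm) _
        · simp
      · rw [indicator_of_notMem hu, Finset.sum_eq_zero]
        exact fun i _ => indicator_of_notMem (fun h => hu h.1) _
    rw [heq, integral_finsetSum]
    · exact Finset.sum_congr rfl fun i _ => integral_indicator_const _ (hS i)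
    · exact fun i _ => (integrable_indicator_iff (hS i)).2 (integrableOn_const (hfin i))
  have hsum := sum_occTime ht hR
  rw [hpos, positionMap_apply]
  rw [Fin.sum_univ_three] at hsum ⊢
  simp only [occPair, planarVel, Matrix.cons_val]
  ext
  · simp only [Prod.fst_add, Prod.smul_fst, smul_eq_mul]
    linear_combination (-(c / 2)) * hsum
  · simp only [Prod.snd_add, Prod.smul_snd, smul_eq_mul]
    linear_combination (-(Real.sqrt 3 * c / 2)) * hsum

theorem measurableSet_openTriangle (c t : ℝ) : MeasurableSet (openTriangle c t) := by
  unfold openTriangle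
  measurability

variable [MeasurableSpace Ω] {P : Measure Ω} {A : Fin 3 → Finset (Fin 3)}
  {lam : ℝ → ℝ} {Γ : Ω → Set ℝ} {D : ℝ → Ω → Fin 3}

theorem IsDirectionOfMotion.measurable_planarPosition (h : IsDirectionOfMotion P A lam Γ D)
    (c : ℝ) (ht : 0 < t) : Measurable (planarPosition c D t) := by
  have : planarPosition c D t = positionMap c t ∘ occPair D 0 1 t :=
    funext fun ω => planarPosition_eq ht (h.rightConst ω)
  rw [this]
  exact (measurable_positionMap c t).comp
    (measurable_occPair ht h.measurable_direction h.rightConst 0 1)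

/-- The density of the occupation times, expressed by the density of the position. -/
theorem IsDirectionOfMotion.isDensityOn_occPair (h : IsDirectionOfMotion P A lam Γ D)
    (hc : 0 < c) (ht : 0 < t) {f : ℝ → ℝ → ℝ}
    (hf : IsDensityOn P (planarPosition c D t) (openTriangle c t) f) :
    IsDensityOn P (occPair D 0 1 t) (openSimplex t) (fun s r => 3 * Real.sqrt 3 * c ^ 2 / 2 *
      f (c / 2 * (3 * s - t)) (Real.sqrt 3 * c / 2 * (s + 2 * r - t))) := by
  obtain ⟨hfm, hf0, hfB⟩ := hf
  have hd : 0 < 3 * Real.sqrt 3 * c ^ 2 / 2 := by positivity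
  have hcomp : ∀ z : ℝ × ℝ, f (c / 2 * (3 * z.1 - t))
      (Real.sqrt 3 * c / 2 * (z.1 + 2 * z.2 - t)) =
      Function.uncurry f (positionMap c t z) := fun z => by rw [positionMap_apply]; rfl
  refine ⟨?_, fun z hz => ?_, fun B hB hBt => ?_⟩
  · have hunc : Function.uncurry (fun s r => 3 * Real.sqrt 3 * c ^ 2 / 2 *
        f (c / 2 * (3 * s - t)) (Real.sqrt 3 * c / 2 * (s + 2 * r - t))) =
        fun z => 3 * Real.sqrt 3 * c ^ 2 / 2 * Function.uncurry f (positionMap c t z) :=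
      funext fun z => congrArg _ (hcomp z)
    rw [hunc]
    exact (hfm.comp (measurable_positionMap c t)).const_mul _
  · refine mul_nonneg hd.le ?_
    rw [hcomp]
    exact hf0 _ ((positionMap_mem_openTriangle_iff hc z).2 hz)
  · let S := positionInv c t ⁻¹' B
    have hS : MeasurableSet S := measurable_positionInv c t hB
    have hBS : positionMap c t ⁻¹' S = B := by
      ext z
      simp only [S, mem_preimage, positionInv_positionMap hc.ne']
    have hSt : S ⊆ openTriangle c t := fun z hz => by
      rw [← positionMap_positionInv (t := t) hc.ne' z, positionMap_mem_openTriangle_iff hc]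
      exact hBt hz
    have hP : P (occPair D 0 1 t ⁻¹' B) = P (planarPosition c D t ⁻¹' S) := by
      rw [← hBS]
      congr 1
      ext ω
      simp only [mem_preimage, planarPosition_eq ht (h.rightConst ω)]
    have hfm' : Measurable fun z : ℝ × ℝ => ENNReal.ofReal (Function.uncurry f z) :=
      hfm.ennreal_ofReal
    have hchange := setLIntegral_map hS hfm' (measurable_positionMap c t) (μ := volume)
    rw [map_positionMap_volume hc, Measure.restrict_smul, lintegral_smul_measure, hBS,
      smul_eq_mul] at hchange
    rw [hP, hfB S hS hSt]
    simp only [hcomp, ENNReal.ofReal_mul hd.le]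
    rw [lintegral_const_mul _ (f := fun z => ENNReal.ofReal (Function.uncurry f (positionMap c t z)))
      (hfm'.comp (measurable_positionMap c t)), ← hchange, ← mul_assoc,
      ENNReal.mul_inv_cancel (ENNReal.ofReal_pos.2 hd).ne' ENNReal.ofReal_ne_top, one_mul]
    rfl

variable [IsFiniteMeasure P]

/-- The planar motion has a transition density. -/
theorem IsDirectionOfMotion.exists_isTransitionDensity (h : IsDirectionOfMotion P A lam Γ D)
    (hint : ∀ s t, 0 < s → s ≤ t → IntervalIntegrable lam volume s t)
    (hpos : ∀ t, 0 < t → 0 < lam t) (hc : 0 < c) :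
    ∃ q : ℝ → ℝ → ℝ → ℝ, IsTransitionDensity P c D q := by
  -- Restricted to the open triangle, since the full law may charge the boundary, for example when a
  -- path has no events up to `t`.
  let μ : ℝ → Measure (ℝ × ℝ) := fun t =>
    (P.map (planarPosition c D t)).restrict (openTriangle c t)
  refine ⟨fun t x y => ((μ t).rnDeriv volume (x, y)).toReal, fun t ht => ⟨?_, ?_, ?_⟩⟩
  · exact (Measure.measurable_rnDeriv (μ t) volume).ennreal_toReal
  · exact fun z _ => ENNReal.toReal_nonneg
  · intro B hB hBt
    have hm := h.measurable_planarPosition c ht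
    have hac : μ t ≪ volume := by
      refine Measure.AbsolutelyContinuous.mk fun N hN hN0 => ?_
      rw [Measure.restrict_apply hN, Measure.map_apply hm
        (hN.inter (measurableSet_openTriangle c t))]
      have hpre : planarPosition c D t ⁻¹' (N ∩ openTriangle c t) =
          occPair D 0 1 t ⁻¹' (positionMap c t ⁻¹' (N ∩ openTriangle c t)) := by
        ext ω
        simp only [mem_preimage, planarPosition_eq ht (h.rightConst ω)]
      rw [hpre]
      refine h.measure_occPair_eq_zero hint hpos ht
        (measurable_positionMap c t (hN.inter (measurableSet_openTriangle c t)))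
        (fun z hz => (positionMap_mem_openTriangle_iff hc z).1 hz.2) ?_
      rw [← Measure.map_apply (measurable_positionMap c t)
        (hN.inter (measurableSet_openTriangle c t)), map_positionMap_volume hc,
        Measure.smul_apply, measure_mono_null inter_subset_left hN0, smul_zero]
    have hB' : P (planarPosition c D t ⁻¹' B) = μ t B := by
      rw [Measure.restrict_apply hB, inter_eq_left.2 hBt, Measure.map_apply hm hB]
    rw [hB', ← Measure.setLIntegral_rnDeriv hac B]
    refine setLIntegral_congr_fun_ae hB ?_
    filter_upwards [Measure.rnDeriv_lt_top (μ t) volume] with z hz _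
    exact (ENNReal.ofReal_toReal hz.ne).symm

end Planar

/-! ### Transfer from the planar motion to the axis times -/

section AxisTimes

variable {Ω Ω' : Type*} [MeasurableSpace Ω] [MeasurableSpace Ω'] {P : Measure Ω}
  [IsFiniteMeasure P] {P' : Measure Ω'} [IsFiniteMeasure P'] {A : Fin 3 → Finset (Fin 3)}
  {lam : ℝ → ℝ} {c : ℝ} {Γ : Ω → Set ℝ} {D : ℝ → Ω → Fin 6} {Γ' : Ω' → Set ℝ}
  {D' : ℝ → Ω' → Fin 3}

theorem axisTimes_of_isDirectionOfMotion_axisOf (hc : 0 < c)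
    (hlam : ContinuousOn lam (Ioi 0)) (hpos : ∀ t, 0 < t → 0 < lam t)
    (h : IsDirectionOfMotion P A lam Γ fun u ω => axisOf (D u ω))
    (h' : IsDirectionOfMotion P' A lam Γ' D') :
    (∃ q : ℝ → ℝ → ℝ → ℝ, IsTransitionDensity P' c D' q) ∧
    (∀ t, 0 < t → ∀ᵐ ω ∂P, axisTime c D 0 t ω + axisTime c D 1 t ω + axisTime c D 2 t ω = t) ∧
    ∀ q : ℝ → ℝ → ℝ → ℝ, IsTransitionDensity P' c D' q → ∀ t, 0 < t →
      IsDensityOn P (fun ω => (axisTime c D 0 t ω, axisTime c D 1 t ω)) (openSimplex t)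
        (fun s r => 3 * Real.sqrt 3 * c ^ 2 / 2 *
          q t (c / 2 * (3 * s - t)) (Real.sqrt 3 * c / 2 * (s + 2 * r - t))) := by
  have hint : ∀ s t, 0 < s → s ≤ t → IntervalIntegrable lam volume s t := fun s t hs hst =>
    (hlam.mono fun u hu => hs.trans_le hu.1).intervalIntegrable_of_Icc hst
  refine ⟨h'.exists_isTransitionDensity hint hpos hc, fun t ht => .of_forall fun ω => ?_,
    fun q hq t ht => ?_⟩
  · have hsum := sum_occTime ht (h.rightConst ω)
    rw [Fin.sum_univ_three] at hsum
    simpa only [axisTime_eq_occTime hc.ne'] using hsum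
  · obtain ⟨hm, h0, hB⟩ := h'.isDensityOn_occPair hc ht (hq t ht)
    have hpair : (fun ω => (axisTime c D 0 t ω, axisTime c D 1 t ω)) =
        occPair (fun u ω => axisOf (D u ω)) 0 1 t := by
      funext ω
      simp only [axisTime_eq_occTime hc.ne', occPair]
    refine ⟨hm, h0, fun B hBm hBt => ?_⟩
    rw [hpair, ← hB B hBm hBt,
      ← Measure.map_apply (measurable_occPair ht h.measurable_direction h.rightConst 0 1) hBm,
      h.map_occPair_eq h' ht, Measure.map_apply
        (measurable_occPair ht h'.measurable_direction h'.rightConst 0 1) hBm]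

end AxisTimes

theorem theorem4p2 {Ω Ω' : Type*} [MeasurableSpace Ω] [MeasurableSpace Ω']
    (P : Measure Ω) [IsProbabilityMeasure P] (P' : Measure Ω') [IsProbabilityMeasure P']
    (c : ℝ) (hc : 0 < c)
    (lam : ℝ → ℝ) (hlam : ContDiffOn ℝ 2 lam (Ioi 0)) (hpos : ∀ t, 0 < t → 0 < lam t)
    (Γ : Ω → Set ℝ) (D : ℝ → Ω → Fin 6) (Γ' : Ω' → Set ℝ) (D' : ℝ → Ω' → Fin 3)
    (hmotion : (IsOSM P lam Γ D ∧ IsSymmetricallyDeviatingPlanar P' lam Γ' D') ∨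
      (IsOUM P lam Γ D ∧ IsUniformPlanar P' lam Γ' D')) :
    (∃ q : ℝ → ℝ → ℝ → ℝ, IsTransitionDensity P' c D' q) ∧
    (∀ t, 0 < t → ∀ᵐ ω ∂P, axisTime c D 0 t ω + axisTime c D 1 t ω + axisTime c D 2 t ω = t) ∧
    ∀ q : ℝ → ℝ → ℝ → ℝ, IsTransitionDensity P' c D' q → ∀ t, 0 < t →
      IsDensityOn P (fun ω => (axisTime c D 0 t ω, axisTime c D 1 t ω)) (openSimplex t)
        (fun s r => 3 * Real.sqrt 3 * c ^ 2 / 2 *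
          q t (c / 2 * (3 * s - t)) (Real.sqrt 3 * c / 2 * (s + 2 * r - t))) := by
  rcases hmotion with ⟨h, h'⟩ | ⟨h, h'⟩
  · exact axisTimes_of_isDirectionOfMotion_axisOf hc hlam.continuousOn hpos
      (IsDirectionOfMotion.lump h axisOf (fun b => by convert sum_axisOf_init b)
        (fun i b => by convert sum_axisOf_orthogonal i b)) h'
  · exact axisTimes_of_isDirectionOfMotion_axisOf hc hlam.continuousOn hpos
      (IsDirectionOfMotion.lump h axisOf (fun b => by convert sum_axisOf_init b)
        (fun i b => by convert sum_axisOf_uniform i b)) h'
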